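/- Let $V$ be a complex vector space of dimension $6$. Let $\mathrm{Gr}_3V\subset\mathbb P(\bigwedge^3V)$ be the Grassmannian of $3$-dimensional linear subspaces in its Plücker embedding. Let $Z\subset\bigwedge^3V$ be a linear subspace of dimension $6$, so $\dim\mathbb PZ=5$, such that $\mathbb PZ$ does not meet $\mathrm{Gr}_3V$, and let $$\pi_Z\colon \mathrm{Gr}_3V\longrightarrow\mathbb P\bigl((\textstyle\bigwedge^3V)/Z\bigr)$$ be the restriction to $\mathrm{Gr}_3V$ of the linear projection with center $\mathbb PZ$. Let $d$ be the degree of $\pi_Z$ as a map onto its image, that is, the number of points in the fibers of $\pi_Z$ over a Zariski open dense subset of the image. A form $\sigma\in\bigwedge^2V$ is called a symplectic form on $V^*$ if the alternating bilinear form it defines on $V^*$ is nondegenerate. The subspace $Z$ is called self-adjoint if there is a symplectic form $\sigma\in\bigwedge^2V$ on $V^*$ with $Z\supseteq \mathbb C\sigma\wedge V$. Then $d>1$ if and only if $Z$ is self-adjoint. Moreover, if $d>1$, then $Z=\mathbb C\sigma\wedge V$ for some symplectic form $\sigma\in\bigwedge^2V$ on $V^*$. -/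

import Mathlib

open Module Topology
open scoped LinearAlgebra.Projectivization

namespace GrassmannProjection

section Grassmannian

variable (V : Type*) [AddCommGroup V] [Module ℂ V] [FiniteDimensional ℂ V]

/-- The Grassmannian of `m`-dimensional linear subspaces of `V`. -/
def Gr (m : ℕ) : Type _ := {Λ : Submodule ℂ V // finrank ℂ Λ = m}

variable {V} {m : ℕ}

/-- The line `⋀^m Λ` in `⋀^m V`. It is spanned by `v₁ ∧ ⋯ ∧ v_m` for any basis `v` of `Λ`. -/
noncomputable def Gr.line (Λ : Gr V m) : Submodule ℂ (⋀[ℂ]^m V) :=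
  LinearMap.range (exteriorPower.map m Λ.1.subtype)

theorem Gr.finrank_line (Λ : Gr V m) : finrank ℂ Λ.line = 1 := by
  have hinj : Function.Injective (exteriorPower.map m Λ.1.subtype) :=
    exteriorPower.map_injective_field Λ.1.injective_subtype
  have h := LinearMap.finrank_range_of_inj hinj
  rw [exteriorPower.finrank_eq, Λ.2, Nat.choose_self] at h
  exact h

/-- The Plücker embedding of the Grassmannian into the projective space of `⋀^m V`. -/
noncomputable def plucker (Λ : Gr V m) : ℙ ℂ (⋀[ℂ]^m V) :=
  Projectivization.mk'' Λ.line Λ.finrank_line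

end Grassmannian

section Projection

variable {W : Type*} [AddCommGroup W] [Module ℂ W]

/-- The linear projection from `ℙ W` (minus the center `ℙ Z`) to `ℙ (W / Z)`, at a point `x`
which does not lie in the center. It is induced by the quotient map `W → W / Z`. -/
noncomputable def linearProjection (Z : Submodule ℂ W) (x : ℙ ℂ W) (hx : ¬ x.submodule ≤ Z) :
    ℙ ℂ (W ⧸ Z) :=
  Projectivization.mk ℂ (Z.mkQ x.rep) (by
    rw [Projectivization.submodule_eq, Submodule.span_singleton_le_iff_mem] at hx
    simpa using hx)

variable {V : Type*} [AddCommGroup V] [Module ℂ V] [FiniteDimensional ℂ V] {m : ℕ}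

/-- The linear subspace `ℙ Z` does not meet the Grassmannian. -/
def IsDisjointFromGr (Z : Submodule ℂ (⋀[ℂ]^m V)) : Prop :=
  ∀ Λ : Gr V m, ¬ (plucker Λ).submodule ≤ Z

/-- The restriction `π_Z` to the Grassmannian of the linear projection with center `ℙ Z`. -/
noncomputable def grProjection (Z : Submodule ℂ (⋀[ℂ]^m V)) (hZ : IsDisjointFromGr Z) :
    Gr V m → ℙ ℂ ((⋀[ℂ]^m V) ⧸ Z) :=
  fun Λ => linearProjection Z (plucker Λ) (hZ Λ)

end Projection

section Degree

/-- The Zariski topology on the projective space of a finite-dimensional complex vector space `E`.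
A basis of open sets is given by the loci where one homogeneous polynomial in the linear
functions on `E` does not vanish (this does not depend on the representative of a point). -/
@[reducible]
def zariskiTopology (E : Type*) [AddCommGroup E] [Module ℂ E] : TopologicalSpace (ℙ ℂ E) :=
  TopologicalSpace.generateFrom
    {U | ∃ (k : ℕ) (p : MvPolynomial (Dual ℂ E) ℂ), p.IsHomogeneous k ∧
      U = {x | MvPolynomial.eval (fun f : Dual ℂ E => f x.rep) p ≠ 0}}

/-- The map `F`, viewed as a map onto its image, has degree `d`: over a Zariski open dense
subset of the image of `F`, every fiber consists of exactly `d` points. -/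
def HasDegree {X E : Type*} [AddCommGroup E] [Module ℂ E] (F : X → ℙ ℂ E) (d : ℕ) : Prop :=
  ∃ U : Set (ℙ ℂ E), IsOpen[zariskiTopology E] U ∧
    Set.range F ⊆ closure[zariskiTopology E] (U ∩ Set.range F) ∧
    ∀ y ∈ U ∩ Set.range F, (F ⁻¹' {y}).encard = d

end Degree

section SelfAdjoint

variable {V : Type*} [AddCommGroup V] [Module ℂ V]

/-- The alternating bilinear form on `V*` given by a 2-form `σ ∈ ⋀² V`:
`σ = v ∧ w` gives `(f, g) ↦ f v * g w - f w * g v`. -/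
noncomputable def dualForm (σ : ⋀[ℂ]^2 V) (f g : Dual ℂ V) : ℂ :=
  exteriorPower.pairingDual ℂ V 2 (exteriorPower.ιMulti ℂ 2 ![f, g]) σ

/-- The 2-form `σ ∈ ⋀² V` is a symplectic form on `V*`, i.e. nondegenerate. -/
def IsSymplectic (σ : ⋀[ℂ]^2 V) : Prop :=
  ∀ f : Dual ℂ V, (∀ g : Dual ℂ V, dualForm σ f g = 0) → f = 0

/-- The subspace `ℂσ ∧ ⋀^(m-2) V` of `⋀^m V`, for `2 ≤ m`; the product is taken in the exterior
algebra. -/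
noncomputable def wedgeSubspace (m : ℕ) (σ : ⋀[ℂ]^2 V) : Submodule ℂ (⋀[ℂ]^m V) :=
  (Submodule.span ℂ {(σ : ExteriorAlgebra ℂ V)} * (⋀[ℂ]^(m - 2) V)).comap
    (⋀[ℂ]^m V).subtype

/-- A subspace `Z` of `⋀^m V` is self-adjoint if it contains `ℂσ ∧ ⋀^(m-2) V` for some symplectic
form `σ` on `V*`. -/
def IsSelfAdjoint {m : ℕ} (Z : Submodule ℂ (⋀[ℂ]^m V)) : Prop :=
  ∃ σ : ⋀[ℂ]^2 V, IsSymplectic σ ∧ wedgeSubspace m σ ≤ Z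

end SelfAdjoint

end GrassmannProjection

/-! Suppose `d > 1`. Take a point `p` of the Grassmannian whose coordinates are algebraically
independent over a countable field `k` over which `Z` and the wedge product are defined. A second
point of its fiber gives, after scaling, `p + p' ∈ Z` with `p'` decomposable. Derivations of `ℂ`
over `k`, acting on coordinates, obey the Leibniz rule, preserve `Z`, and move `p` along any tangent
vector of the Grassmannian; they replace differentiation along a family of fibers.

The two 3-spaces must meet in a line. If they meet in `0`, the tangent spaces at `p` and `p'` are
independent and the derivatives of `p + p'` do not fit into dimension 6
(`LeibnizAction.false_of_disjoint`). If they meet in a plane, `p + p'` is itself decomposable,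
contrary to disjointness. So `p + p' = b₀ ∧ ω` with `ω = b₁ ∧ b₂ + b₃ ∧ b₄`, and the dimension count
is tight: each `u ∈ Z` is a derivative of `b₀ ∧ ω`, hence `u = x ∧ ω + b₀ ∧ η`
(`LeibnizAction.exists_derivative_eq`). Second derivatives lie in `Z` too, so `x ∧ η' + x' ∧ η ∈ V ∧
ω` modulo `b₀` for all pairs `u, u' ∈ Z` (`LeibnizAction.mixedCoef_eq_zero`). This bilinear
identity, with the absence of decomposables in `Z`, forces `Z = (ω + b₀ ∧ y) ∧ V`, and the 2-form is
symplectic (`exists_eq_wedgeSubspace`).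

Conversely, let `ω` now be the symplectic form on `V` inverse to `σ`. A generic 3-space is not
isotropic, so it is spanned by `v₀, v₁, v₄` in a symplectic basis with `σ = v₀ ∧ v₁ + v₂ ∧ v₃ + v₄ ∧
v₅`. As `v₄ ∧ σ ∈ Z`, the span of `v₄, v₂, v₃` lies in the same fiber (`exists_ne_grProjection_eq`).
-/

namespace GrassmannProjection

/-! ### Generic complex points and derivations of `ℂ`. -/

section Generic
open scoped IntermediateField.algebraAdjoinAdjoin

/-- A derivation of a field of characteristic zero can be prescribed freely on a transcendence
basis. -/
theorem exists_derivation_of_isTranscendenceBasis {k L ι : Type*} [Field k] [Field L] [CharZero L]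
    [Algebra k L] {v : ι → L} (hv : IsTranscendenceBasis k v) (x : ι → L) :
    ∃ D : Derivation k L L, ∀ i, D (v i) = x i := by
  classical
  have hk : CharZero k := (algebraMap k L).charZero_iff (algebraMap k L).injective |>.2 inferInstance
  let S := Algebra.adjoin k (Set.range v)
  let F := IntermediateField.adjoin k (Set.range v)
  have : Algebra.IsAlgebraic F L := hv.isAlgebraic_field
  have hF : CharZero F := (algebraMap k F).charZero_iff (algebraMap k F).injective |>.1 hk
  -- Localization and separable algebraic extension are both formally étale, so a derivation on the
  -- polynomial ring `S` extends to `L`.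
  have h1 : Algebra.FormallyEtale F L := Algebra.FormallyEtale.of_isSeparable _ _
  have h2 : Algebra.FormallyEtale S F := .of_isLocalization (nonZeroDivisors _)
  have h3 : Algebra.FormallyEtale S L := .comp S F L
  let e : MvPolynomial ι k ≃ₐ[k] S := hv.1.aevalEquiv
  have he : ∀ i, e.symm ⟨v i, Algebra.subset_adjoin ⟨i, rfl⟩⟩ = MvPolynomial.X i := fun i => by
    rw [AlgEquiv.symm_apply_eq]
    apply Subtype.ext
    exact ((hv.1.algebraMap_aevalEquiv (MvPolynomial.X i)).trans (MvPolynomial.aeval_X v i)).symm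
  obtain ⟨d, hd⟩ : ∃ d : Derivation k S L,
      ∀ i, d ⟨v i, Algebra.subset_adjoin ⟨i, rfl⟩⟩ = x i := by
    let : Module (MvPolynomial ι k) L := Module.compHom L e.toRingEquiv.toRingHom
    have hsm : ∀ (p : MvPolynomial ι k) (y : L), p • y = e p • y := fun _ _ => rfl
    have : IsScalarTower k (MvPolynomial ι k) L := ⟨fun c p y => by
      rw [hsm, hsm, map_smul, smul_assoc]⟩
    let d0 : Derivation k (MvPolynomial ι k) L := MvPolynomial.mkDerivation k x
    refine ⟨Derivation.mk' (d0.toLinearMap ∘ₗ e.symm.toLinearMap) (fun a b => by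
      simp [hsm]), fun i => ?_⟩
    change d0 (e.symm _) = x i
    rw [he, MvPolynomial.mkDerivation_X]
  let l : Ω[L⁄k] →ₗ[L] L := (LinearMap.liftBaseChange L d.liftKaehlerDifferential) ∘ₗ
    (KaehlerDifferential.tensorKaehlerEquivOfFormallyEtale k S L).symm.toLinearMap
  refine ⟨l.compDer (KaehlerDifferential.D k L), fun i => ?_⟩
  have h := KaehlerDifferential.tensorKaehlerEquivOfFormallyEtale_symm_D_algebraMap k S L
    ⟨v i, Algebra.subset_adjoin ⟨i, rfl⟩⟩
  change LinearMap.liftBaseChange L d.liftKaehlerDifferential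
    ((KaehlerDifferential.tensorKaehlerEquivOfFormallyEtale k S L).symm
      (KaehlerDifferential.D k L (algebraMap S L ⟨v i, Algebra.subset_adjoin ⟨i, rfl⟩⟩))) = x i
  rw [h]
  simp [hd]

/-- Points which are generic over a given countable set of complex numbers: they avoid a given
hypersurface, and their coordinates can be differentiated freely. -/
theorem exists_generic_point {σ : Type} [Finite σ] (S : Set ℂ) (hS : S.Countable)
    (G : MvPolynomial σ ℂ) (hG : G ≠ 0) :
    ∃ (k : Subfield ℂ) (a : σ → ℂ), S ⊆ k ∧ MvPolynomial.eval a G ≠ 0 ∧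
      ∀ x : σ → ℂ, ∃ D : Derivation k ℂ ℂ, ∀ i, D (a i) = x i := by
  classical
  -- Adjoining the coefficients of `G` puts `G` over `k`, so it cannot vanish at an algebraically
  -- independent point.
  let T : Set ℂ := S ∪ G.coeffs
  let k := Subfield.closure T
  have hT : T.Countable := hS.union (Finset.countable_toSet _)
  have hk : Cardinal.mk k ≤ Cardinal.aleph0 :=
    (Subfield.cardinalMk_closure_le_max T).trans (max_le hT.le_aleph0 le_rfl)
  obtain ⟨ι, v, hv⟩ := exists_isTranscendenceBasis' k ℂ
  have hι : Cardinal.mk ℂ = Cardinal.mk ι := by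
    refine IsAlgClosed.cardinal_eq_cardinal_transcendence_basis_of_aleph0_lt' v hv hk ?_
    rw [Cardinal.mk_complex]
    exact Cardinal.aleph0_lt_continuum
  have hinf : Infinite ι := by
    rw [Cardinal.infinite_iff, ← hι]
    exact Cardinal.infinite_iff.1 inferInstance
  obtain ⟨f⟩ : Nonempty (σ ↪ ι) := by
    obtain ⟨n, ⟨g⟩⟩ := Finite.exists_equiv_fin σ
    exact ⟨g.toEmbedding.trans (Fin.valEmbedding.trans (Infinite.natEmbedding ι))⟩
  refine ⟨k, v ∘ f, (Set.subset_union_left).trans Subfield.subset_closure, ?_, fun x => ?_⟩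
  · have hGk : (G.coeffs : Set ℂ) ⊆ Set.range (algebraMap k ℂ) := by
      intro c hc
      exact ⟨⟨c, Subfield.subset_closure (Or.inr hc)⟩, rfl⟩
    obtain ⟨G', hG'⟩ := (MvPolynomial.mem_range_map_iff_coeffs_subset).2 hGk
    rw [← hG', MvPolynomial.eval_map]
    intro h
    apply hG
    rw [← hG', (hv.1.comp f f.injective).eq_zero_of_aeval_eq_zero G' h, map_zero]
  -- The value 0 on the basis elements outside the range of `f` is arbitrary.
  · obtain ⟨D, hD⟩ := exists_derivation_of_isTranscendenceBasis hv
      (fun i => if h : ∃ j, f j = i then x h.choose else 0)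
    refine ⟨D, fun j => ?_⟩
    have h : ∃ j', f j' = f j := ⟨j, rfl⟩
    rw [Function.comp_apply, hD, dif_pos h]
    exact congrArg x (f.injective h.choose_spec)

end Generic

/-! ### Trilinear wedge product and coefficients of 3-forms. -/

section Wedge

variable {V : Type*} [AddCommGroup V] [Module ℂ V]

theorem update_vec3_zero {α : Type*} (x y z t : α) :
    Function.update ![x, y, z] 0 t = ![t, y, z] := by
  ext i; fin_cases i <;> rfl

theorem update_vec3_one {α : Type*} (x y z t : α) :
    Function.update ![x, y, z] 1 t = ![x, t, z] := by
  ext i; fin_cases i <;> rfl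

theorem update_vec3_two {α : Type*} (x y z t : α) :
    Function.update ![x, y, z] 2 t = ![x, y, t] := by
  ext i; fin_cases i <;> rfl

/-- The product `x ∧ y ∧ z` in `⋀³ V`, as a trilinear map. -/
noncomputable def wedge3 : V →ₗ[ℂ] V →ₗ[ℂ] V →ₗ[ℂ] ⋀[ℂ]^3 V :=
  LinearMap.mk₂ ℂ (fun x y =>
    { toFun := fun z => exteriorPower.ιMulti ℂ 3 ![x, y, z]
      map_add' := fun z z' => by
        have h := (exteriorPower.ιMulti ℂ 3).map_update_add ![x, y, z] 2 z z'
        simp only [update_vec3_two] at h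
        exact h
      map_smul' := fun c z => by
        have h := (exteriorPower.ιMulti ℂ 3).map_update_smul ![x, y, z] 2 c z
        simp only [update_vec3_two] at h
        exact h })
    (fun x x' y => LinearMap.ext fun z => by
        have h := (exteriorPower.ιMulti ℂ 3).map_update_add ![x, y, z] 0 x x'
        simp only [update_vec3_zero] at h
        exact h)
    (fun c x y => LinearMap.ext fun z => by
        have h := (exteriorPower.ιMulti ℂ 3).map_update_smul ![x, y, z] 0 c x
        simp only [update_vec3_zero] at h
        exact h)
    (fun x y y' => LinearMap.ext fun z => by
        have h := (exteriorPower.ιMulti ℂ 3).map_update_add ![x, y, z] 1 y y'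
        simp only [update_vec3_one] at h
        exact h)
    (fun c x y => LinearMap.ext fun z => by
        have h := (exteriorPower.ιMulti ℂ 3).map_update_smul ![x, y, z] 1 c y
        simp only [update_vec3_one] at h
        exact h)

theorem wedge3_apply (x y z : V) : wedge3 x y z = exteriorPower.ιMulti ℂ 3 ![x, y, z] := rfl

theorem ιMulti_eq_wedge3 (e : Fin 3 → V) :
    exteriorPower.ιMulti ℂ 3 e = wedge3 (e 0) (e 1) (e 2) := by
  rw [wedge3_apply]
  congr 1
  ext i
  fin_cases i <;> rfl

theorem coe_wedge3 (x y z : V) : (wedge3 x y z : ExteriorAlgebra ℂ V) =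
    ExteriorAlgebra.ι ℂ x * ExteriorAlgebra.ι ℂ y * ExteriorAlgebra.ι ℂ z := by
  simp [wedge3_apply, ExteriorAlgebra.ιMulti_apply, mul_assoc]

/-- The coefficient of a 3-form at `b i ∧ b j ∧ b k`. -/
noncomputable def coef {ι : Type*} (b : Basis ι ℂ V) (i j k : ι) : ⋀[ℂ]^3 V →ₗ[ℂ] ℂ :=
  exteriorPower.pairingDual ℂ V 3 (exteriorPower.ιMulti ℂ 3 ![b.coord i, b.coord j, b.coord k])

theorem coef_wedge3 {ι : Type*} (b : Basis ι ℂ V) (i j k : ι) (x y z : V) :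
    coef b i j k (wedge3 x y z) =
      b.repr x i * (b.repr y j * b.repr z k - b.repr y k * b.repr z j)
      - b.repr x j * (b.repr y i * b.repr z k - b.repr y k * b.repr z i)
      + b.repr x k * (b.repr y i * b.repr z j - b.repr y j * b.repr z i) := by
  rw [coef, wedge3_apply, exteriorPower.pairingDual_ιMulti_ιMulti, Matrix.det_fin_three]
  simp
  ring

theorem ext_coef {ι : Type*} [LinearOrder ι] (b : Basis ι ℂ V) {s t : ⋀[ℂ]^3 V}
    (h : ∀ i j k, i < j → j < k → coef b i j k s = coef b i j k t) : s = t := by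
  apply (b.exteriorPower 3).repr.injective
  ext u
  rw [exteriorPower.basis_repr_apply, exteriorPower.basis_repr_apply]
  have hu := h (Set.powersetCard.ofFinEmbEquiv.symm u 0) (Set.powersetCard.ofFinEmbEquiv.symm u 1)
    (Set.powersetCard.ofFinEmbEquiv.symm u 2) (by simp) (by simp)
  have hc : exteriorPower.ιMultiDual ℂ 3 b u = coef b (Set.powersetCard.ofFinEmbEquiv.symm u 0)
      (Set.powersetCard.ofFinEmbEquiv.symm u 1) (Set.powersetCard.ofFinEmbEquiv.symm u 2) := by
    rw [exteriorPower.ιMultiDual, exteriorPower.ιMulti_family, coef]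
    congr 2
  rw [hc, hu]

theorem ιMulti_ne_zero {e : Fin 3 → V} (he : LinearIndependent ℂ e) :
    exteriorPower.ιMulti ℂ 3 e ≠ 0 := by
  have hc : (Finset.univ : Finset (Fin 3)).card = 3 := rfl
  have h := (exteriorPower.ιMulti_family_linearIndependent_field (n := 3) he).ne_zero
    ⟨Finset.univ, hc⟩
  have hs : ⇑(Set.powersetCard.ofFinEmbEquiv.symm
      (⟨Finset.univ, hc⟩ : Set.powersetCard (Fin 3) 3)) = id := by
    rw [Set.powersetCard.ofFinEmbEquiv_symm_apply]
    exact (Finset.orderEmbOfFin_unique hc (fun _ => Finset.mem_univ _) strictMono_id).symm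
  rwa [exteriorPower.ιMulti_family, hs] at h

theorem linearIndependent_of_wedge3_ne_zero {x y z : V} (h : wedge3 x y z ≠ 0) :
    LinearIndependent ℂ ![x, y, z] := by
  by_contra hl
  exact h ((exteriorPower.ιMulti ℂ 3).map_linearDependent _ hl)

end Wedge

/-! ### Fibers of the projection in terms of decomposable forms. -/

section Pluecker

variable {V : Type*} [AddCommGroup V] [Module ℂ V] [FiniteDimensional ℂ V]

/-- The span of three linearly independent vectors as a point of the Grassmannian. -/
def Gr.ofLinearIndependent (e : Fin 3 → V) (he : LinearIndependent ℂ e) : Gr V 3 :=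
  ⟨Submodule.span ℂ (Set.range e), by rw [finrank_span_eq_card he, Fintype.card_fin]⟩

theorem Gr.exists_basis (Λ : Gr V 3) :
    ∃ (e : Fin 3 → V) (he : LinearIndependent ℂ e), Λ = Gr.ofLinearIndependent e he := by
  let b := finBasisOfFinrankEq ℂ Λ.1 Λ.2
  have he : LinearIndependent ℂ (Λ.1.subtype ∘ b) :=
    b.linearIndependent.map' _ (Submodule.ker_subtype _)
  refine ⟨_, he, Subtype.ext ?_⟩
  change Λ.1 = Submodule.span ℂ (Set.range (Λ.1.subtype ∘ b))
  rw [Set.range_comp, Submodule.span_image, b.span_eq, Submodule.map_top, Submodule.range_subtype]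

theorem plucker_ofLinearIndependent_submodule (e : Fin 3 → V) (he : LinearIndependent ℂ e) :
    (plucker (Gr.ofLinearIndependent e he)).submodule =
      Submodule.span ℂ {exteriorPower.ιMulti ℂ 3 e} := by
  rw [plucker, Projectivization.submodule_mk'']
  symm
  apply Submodule.eq_of_le_of_finrank_eq
  · rw [Submodule.span_singleton_le_iff_mem]
    refine ⟨exteriorPower.ιMulti ℂ 3 fun i => ⟨e i, Submodule.subset_span ⟨i, rfl⟩⟩, ?_⟩
    rw [exteriorPower.map_apply_ιMulti]
    rfl
  · rw [finrank_span_singleton (ιMulti_ne_zero he), Gr.finrank_line]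

theorem eq_zero_of_wedge3_mem {Z : Submodule ℂ (⋀[ℂ]^3 V)} (hZ : IsDisjointFromGr Z) {x y z : V}
    (h : wedge3 x y z ∈ Z) : wedge3 x y z = 0 := by
  by_contra h0
  have hl := linearIndependent_of_wedge3_ne_zero h0
  apply hZ (Gr.ofLinearIndependent _ hl)
  rw [plucker_ofLinearIndependent_submodule, Submodule.span_singleton_le_iff_mem]
  exact h

theorem mkQ_ιMulti_ne_zero {Z : Submodule ℂ (⋀[ℂ]^3 V)} (hZ : IsDisjointFromGr Z)
    {e : Fin 3 → V} (he : LinearIndependent ℂ e) : Z.mkQ (exteriorPower.ιMulti ℂ 3 e) ≠ 0 := by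
  intro h
  have h' : exteriorPower.ιMulti ℂ 3 e ∈ Z := by simpa using h
  rw [ιMulti_eq_wedge3] at h'
  apply ιMulti_ne_zero he
  rw [ιMulti_eq_wedge3]
  exact eq_zero_of_wedge3_mem hZ h'

theorem grProjection_ofLinearIndependent {Z : Submodule ℂ (⋀[ℂ]^3 V)} (hZ : IsDisjointFromGr Z)
    (e : Fin 3 → V) (he : LinearIndependent ℂ e) :
    grProjection Z hZ (Gr.ofLinearIndependent e he) =
      Projectivization.mk ℂ (Z.mkQ (exteriorPower.ιMulti ℂ 3 e)) (mkQ_ιMulti_ne_zero hZ he) := by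
  have h : (plucker (Gr.ofLinearIndependent e he)).rep ∈
      Submodule.span ℂ {exteriorPower.ιMulti ℂ 3 e} := by
    rw [← plucker_ofLinearIndependent_submodule e he, Projectivization.submodule_eq]
    exact Submodule.mem_span_singleton_self _
  obtain ⟨c, hc⟩ := Submodule.mem_span_singleton.1 h
  rw [grProjection, linearProjection, Projectivization.mk_eq_mk_iff']
  exact ⟨c, by rw [← hc, map_smul]⟩

theorem grProjection_eq_iff {Z : Submodule ℂ (⋀[ℂ]^3 V)} (hZ : IsDisjointFromGr Z)
    {e f : Fin 3 → V} (he : LinearIndependent ℂ e) (hf : LinearIndependent ℂ f) :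
    grProjection Z hZ (Gr.ofLinearIndependent e he) =
      grProjection Z hZ (Gr.ofLinearIndependent f hf) ↔
    ∃ c : ℂ, exteriorPower.ιMulti ℂ 3 e - c • exteriorPower.ιMulti ℂ 3 f ∈ Z := by
  rw [grProjection_ofLinearIndependent, grProjection_ofLinearIndependent,
    Projectivization.mk_eq_mk_iff']
  refine exists_congr fun c => ?_
  rw [← map_smul, eq_comm, ← sub_eq_zero, ← map_sub, Submodule.mkQ_apply,
    Submodule.Quotient.mk_eq_zero]

end Pluecker

/-! ### Zariski open conditions as polynomials in a triple of vectors. -/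

section GenericTriple

theorem eval_mul_left_of_isHomogeneous {σ R : Type*} [CommSemiring R] {p : MvPolynomial σ R}
    {m : ℕ} (hp : p.IsHomogeneous m) (c : R) (x : σ → R) :
    MvPolynomial.eval (fun i => c * x i) p = c ^ m * MvPolynomial.eval x p := by
  rw [MvPolynomial.eval_eq, MvPolynomial.eval_eq, Finset.mul_sum]
  refine Finset.sum_congr rfl fun d hd => ?_
  have hdeg : ∑ i ∈ d.support, d i = m := by
    have h := hp (MvPolynomial.mem_support_iff.1 hd)
    rw [Finsupp.weight_apply] at h
    simpa [Finsupp.sum] using h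
  simp only [mul_pow]
  rw [Finset.prod_mul_distrib, Finset.prod_pow_eq_pow_sum, hdeg]
  ring

variable {V : Type*} [AddCommGroup V] [Module ℂ V]

theorem wedge3_eq_sum {n : ℕ} (b : Basis (Fin n) ℂ V) (x y z : V) :
    wedge3 x y z = ∑ i, ∑ j, ∑ k, (b.repr x i * b.repr y j * b.repr z k) •
      wedge3 (b i) (b j) (b k) := by
  have h1 : ∀ y z, wedge3 x y z = ∑ i, b.repr x i • wedge3 (b i) y z := fun y z => by
    conv_lhs => rw [← b.sum_repr x]
    simp only [map_sum, LinearMap.sum_apply, map_smul, LinearMap.smul_apply]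
  have h2 : ∀ x z, wedge3 x y z = ∑ i, b.repr y i • wedge3 x (b i) z := fun x z => by
    conv_lhs => rw [← b.sum_repr y]
    simp only [map_sum, LinearMap.sum_apply, map_smul, LinearMap.smul_apply]
  have h3 : ∀ x y, wedge3 x y z = ∑ i, b.repr z i • wedge3 x y (b i) := fun x y => by
    conv_lhs => rw [← b.sum_repr z]
    simp only [map_sum, map_smul]
  rw [h1]
  refine Finset.sum_congr rfl fun i _ => ?_
  rw [h2, Finset.smul_sum]
  refine Finset.sum_congr rfl fun j _ => ?_
  rw [h3, Finset.smul_sum, Finset.smul_sum]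
  exact Finset.sum_congr rfl fun k _ => by rw [smul_smul, smul_smul, mul_assoc]

/-- A linear functional of `e₀ ∧ e₁ ∧ e₂` as a polynomial in the coordinates of `e`. -/
noncomputable def triplePoly {n : ℕ} (b : Basis (Fin n) ℂ V) (φ : ⋀[ℂ]^3 V →ₗ[ℂ] ℂ) :
    MvPolynomial (Fin 3 × Fin n) ℂ :=
  ∑ i, ∑ j, ∑ k, MvPolynomial.X (0, i) * MvPolynomial.X (1, j) * MvPolynomial.X (2, k) *
    MvPolynomial.C (φ (wedge3 (b i) (b j) (b k)))

theorem eval_triplePoly {n : ℕ} (b : Basis (Fin n) ℂ V) (φ : ⋀[ℂ]^3 V →ₗ[ℂ] ℂ) (e : Fin 3 → V) :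
    MvPolynomial.eval (fun q : Fin 3 × Fin n => b.repr (e q.1) q.2) (triplePoly b φ) =
      φ (exteriorPower.ιMulti ℂ 3 e) := by
  rw [ιMulti_eq_wedge3, wedge3_eq_sum b]
  simp [triplePoly, map_sum]

variable [FiniteDimensional ℂ V]

/-- The preimage of a Zariski open set in the space of triples of vectors contains a basic open
neighbourhood of each of its points. -/
theorem exists_poly_of_isOpen {n : ℕ} (b : Basis (Fin n) ℂ V)
    {Z : Submodule ℂ (⋀[ℂ]^3 V)} (hZ : IsDisjointFromGr Z)
    {U : Set (ℙ ℂ ((⋀[ℂ]^3 V) ⧸ Z))} (hU : IsOpen[zariskiTopology _] U)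
    (e₀ : Fin 3 → V) (he₀ : LinearIndependent ℂ e₀)
    (hmem : grProjection Z hZ (Gr.ofLinearIndependent e₀ he₀) ∈ U) :
    ∃ G : MvPolynomial (Fin 3 × Fin n) ℂ,
      MvPolynomial.eval (fun q : Fin 3 × Fin n => b.repr (e₀ q.1) q.2) G ≠ 0 ∧
      ∀ (e : Fin 3 → V) (he : LinearIndependent ℂ e),
        MvPolynomial.eval (fun q : Fin 3 × Fin n => b.repr (e q.1) q.2) G ≠ 0 →
        grProjection Z hZ (Gr.ofLinearIndependent e he) ∈ U := by
  induction hU with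
  | basic s hs =>
    obtain ⟨m, p, hp, rfl⟩ := hs
    -- Each linear form on the quotient pulls back to a cubic in the coordinates of `e`;
    -- substituting these cubics pulls `p` back to triples.
    let ψ : Dual ℂ ((⋀[ℂ]^3 V) ⧸ Z) → MvPolynomial (Fin 3 × Fin n) ℂ :=
      fun f => triplePoly b (f ∘ₗ Z.mkQ)
    have key : ∀ (e : Fin 3 → V) (he : LinearIndependent ℂ e),
        MvPolynomial.eval (fun q : Fin 3 × Fin n => b.repr (e q.1) q.2)
          (MvPolynomial.aeval ψ p) ≠ 0 ↔
        grProjection Z hZ (Gr.ofLinearIndependent e he) ∈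
          {x : ℙ ℂ ((⋀[ℂ]^3 V) ⧸ Z) |
            MvPolynomial.eval (fun f : Dual ℂ ((⋀[ℂ]^3 V) ⧸ Z) => f x.rep) p ≠ 0} := by
      intro e he
      rw [grProjection_ofLinearIndependent, Set.mem_ofPred_eq]
      -- The chosen representative differs from the wedge by a unit `c`, which by homogeneity only
      -- contributes the factor `c ^ m`.
      obtain ⟨c, hc⟩ := Projectivization.exists_smul_eq_mk_rep ℂ
        (Z.mkQ (exteriorPower.ιMulti ℂ 3 e)) (mkQ_ιMulti_ne_zero hZ he)
      rw [← hc]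
      have h1 : MvPolynomial.eval (fun q : Fin 3 × Fin n => b.repr (e q.1) q.2)
          (MvPolynomial.aeval ψ p) = MvPolynomial.eval
            (fun f : Dual ℂ ((⋀[ℂ]^3 V) ⧸ Z) => f (Z.mkQ (exteriorPower.ιMulti ℂ 3 e))) p := by
        clear hp hmem
        induction p using MvPolynomial.induction_on with
        | C c => simp
        | add p q hp hq => rw [map_add, map_add, map_add, hp, hq]
        | mul_X p f hp =>
          rw [map_mul, map_mul, map_mul, hp, MvPolynomial.aeval_X, MvPolynomial.eval_X,
            eval_triplePoly]
          rfl
      have h2 : MvPolynomial.eval (fun f : Dual ℂ ((⋀[ℂ]^3 V) ⧸ Z) =>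
          f (c • Z.mkQ (exteriorPower.ιMulti ℂ 3 e))) p = (c : ℂ) ^ m * MvPolynomial.eval
            (fun f : Dual ℂ ((⋀[ℂ]^3 V) ⧸ Z) => f (Z.mkQ (exteriorPower.ιMulti ℂ 3 e))) p := by
        rw [← eval_mul_left_of_isHomogeneous hp]
        congr 2
        ext f
        exact map_smul f _ _
      rw [h1, h2]
      simp
    exact ⟨MvPolynomial.aeval ψ p, (key e₀ he₀).2 hmem, fun e he => (key e he).1⟩
  | univ => exact ⟨1, by simp, fun _ _ _ => Set.mem_univ _⟩
  | inter s t _ _ hs ht =>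
    obtain ⟨G, hG, hG'⟩ := hs hmem.1
    obtain ⟨H, hH, hH'⟩ := ht hmem.2
    refine ⟨G * H, by simp [hG, hH], fun e he h => ?_⟩
    rw [map_mul] at h
    exact ⟨hG' e he (left_ne_zero_of_mul h), hH' e he (right_ne_zero_of_mul h)⟩
  | sUnion S _ hS =>
    obtain ⟨s, hs, hm⟩ := hmem
    obtain ⟨G, hG, hG'⟩ := hS s hs hm
    exact ⟨G, hG, fun e he h => ⟨s, hs, hG' e he h⟩⟩

end GenericTriple

/-! ### Derivations of `ℂ` acting through coordinates. -/

section CoordinateDerivation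

variable {k : Subfield ℂ} {ι M : Type*} [Fintype ι] [AddCommGroup M] [Module ℂ M]

/-- A derivation of `ℂ` acts on a vector space with a chosen basis through the coordinates. -/
noncomputable def coordDeriv (b : Basis ι ℂ M) (D : Derivation k ℂ ℂ) : M →+ M where
  toFun x := ∑ i, D (b.repr x i) • b i
  map_zero' := by simp
  map_add' x y := by simp [add_smul, Finset.sum_add_distrib]

theorem coordDeriv_apply (b : Basis ι ℂ M) (D : Derivation k ℂ ℂ) (x : M) :
    coordDeriv b D x = ∑ i, D (b.repr x i) • b i := rfl

theorem repr_coordDeriv (b : Basis ι ℂ M) (D : Derivation k ℂ ℂ) (x : M) (i : ι) :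
    b.repr (coordDeriv b D x) i = D (b.repr x i) := by
  rw [coordDeriv_apply, b.repr_sum_self]

theorem coordDeriv_smul (b : Basis ι ℂ M) (D : Derivation k ℂ ℂ) (c : ℂ) (x : M) :
    coordDeriv b D (c • x) = D c • x + c • coordDeriv b D x := by
  apply b.ext_elem
  intro i
  simp only [map_add, map_smul, Finsupp.add_apply, Finsupp.smul_apply, smul_eq_mul,
    repr_coordDeriv, Derivation.leibniz]
  ring

theorem coordDeriv_eq_zero (b : Basis ι ℂ M) (D : Derivation k ℂ ℂ) {x : M}
    (hx : ∀ i, b.repr x i ∈ k) : coordDeriv b D x = 0 := by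
  rw [coordDeriv_apply]
  refine Finset.sum_eq_zero fun i _ => ?_
  have h : D (b.repr x i) = 0 := D.map_algebraMap ⟨b.repr x i, hx i⟩
  rw [h, zero_smul]

/-- The structure constants of the wedge product lie in `k`, so `D` kills them and only the
coordinates of the three vectors are differentiated. -/
theorem coordDeriv_wedge3 {V : Type*} [AddCommGroup V] [Module ℂ V] {n : ℕ}
    (b : Basis (Fin n) ℂ V) (B : Basis ι ℂ (⋀[ℂ]^3 V))
    (hk : ∀ i j l m, B.repr (wedge3 (b i) (b j) (b l)) m ∈ k) (D : Derivation k ℂ ℂ) (x y z : V) :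
    coordDeriv B D (wedge3 x y z) = wedge3 (coordDeriv b D x) y z +
      wedge3 x (coordDeriv b D y) z + wedge3 x y (coordDeriv b D z) := by
  rw [wedge3_eq_sum b x y z, wedge3_eq_sum b (coordDeriv b D x) y z,
    wedge3_eq_sum b x (coordDeriv b D y) z, wedge3_eq_sum b x y (coordDeriv b D z)]
  simp only [map_sum, ← Finset.sum_add_distrib]
  refine Finset.sum_congr rfl fun i _ => Finset.sum_congr rfl fun j _ =>
    Finset.sum_congr rfl fun l _ => ?_
  rw [coordDeriv_smul, coordDeriv_eq_zero B D (hk i j l), smul_zero, add_zero, ← add_smul,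
    ← add_smul]
  simp only [repr_coordDeriv, Derivation.leibniz, smul_eq_mul]
  congr 1
  ring

end CoordinateDerivation

/-! ### Leibniz actions preserving `Z`. -/

section Action

variable {V : Type*} [AddCommGroup V] [Module ℂ V]

/-- A space of operators on `V` and on `⋀³ V` satisfying the Leibniz rule, and preserving a
subspace of `⋀³ V`. They need not be `ℂ`-linear, only additive. -/
structure LeibnizAction (𝔇 : Type*) [AddCommGroup 𝔇] [Module ℂ 𝔇]
    (Z : Submodule ℂ (⋀[ℂ]^3 V)) where
  /-- The action on vectors. -/
  onV : 𝔇 → V → V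
  /-- The action on 3-forms. -/
  onForms : 𝔇 →ₗ[ℂ] ((⋀[ℂ]^3 V) → (⋀[ℂ]^3 V))
  onForms_add : ∀ D s t, onForms D (s + t) = onForms D s + onForms D t
  leibniz : ∀ D x y z, onForms D (wedge3 x y z) =
    wedge3 (onV D x) y z + wedge3 x (onV D y) z + wedge3 x y (onV D z)
  map_mem : ∀ D t, t ∈ Z → onForms D t ∈ Z

/-- The action of derivations of `ℂ` through coordinates with respect to bases of `V` and of
`⋀³ V` which are compatible with the wedge product and with `Z`. -/
noncomputable def LeibnizAction.ofBasis {n : ℕ} {ι : Type*} [Fintype ι] {k : Subfield ℂ}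
    (b : Basis (Fin n) ℂ V) (B : Basis ι ℂ (⋀[ℂ]^3 V))
    (hk : ∀ i j l m, B.repr (wedge3 (b i) (b j) (b l)) m ∈ k)
    (Z : Submodule ℂ (⋀[ℂ]^3 V)) (hZ : ∀ t ∈ Z, ∀ i, B.repr t i ≠ 0 → B i ∈ Z) :
    LeibnizAction (Derivation k ℂ ℂ) Z where
  onV D := coordDeriv b D
  onForms :=
    { toFun := fun D => coordDeriv B D
      map_add' := fun D D' => by
        ext1 t
        simp [coordDeriv_apply, add_smul, Finset.sum_add_distrib]
      map_smul' := fun c D => by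
        ext1 t
        simp [coordDeriv_apply, Finset.smul_sum, smul_smul] }
  onForms_add D s t := map_add (coordDeriv B D) s t
  leibniz D x y z := coordDeriv_wedge3 b B hk D x y z
  map_mem D t ht := by
    change coordDeriv B D t ∈ Z
    rw [coordDeriv_apply]
    refine Z.sum_mem fun i _ => ?_
    by_cases h : B.repr t i = 0
    · rw [h, map_zero, zero_smul]
      exact Z.zero_mem
    · exact Z.smul_mem _ (hZ t ht i h)

/-- In such a basis `Z` is a coordinate subspace, hence stable under derivations applied to
coordinates. -/
theorem exists_adapted_basis {K W : Type*} [Field K] [AddCommGroup W] [Module K W]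
    [FiniteDimensional K W] (Z : Submodule K W) :
    ∃ (ι : Type) (_ : Fintype ι) (B : Basis ι K W),
      ∀ t ∈ Z, ∀ i, B.repr t i ≠ 0 → B i ∈ Z := by
  obtain ⟨Z', hZ'⟩ := Z.exists_isCompl
  let B := ((finBasis K Z).prod (finBasis K Z')).map (Z.prodEquivOfIsCompl Z' hZ')
  refine ⟨_, inferInstance, B, fun t ht i hi => ?_⟩
  rcases i with i | i
  · simp [B]
  · exfalso
    apply hi
    have h : (Z.prodEquivOfIsCompl Z' hZ').symm t = (⟨t, ht⟩, 0) :=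
      Submodule.prodEquivOfIsCompl_symm_apply_left Z Z' hZ' ⟨t, ht⟩
    simp [B, h]

/-- `α` factors through the image of `β`. Only the targets need finite dimension, since a space of
derivations may be infinite-dimensional. -/
theorem finrank_le_finrank_range_of_ker_le {K 𝔇 E F : Type*} [Field K] [AddCommGroup 𝔇] [Module K 𝔇]
    [AddCommGroup E] [Module K E] [AddCommGroup F] [Module K F]
    [FiniteDimensional K E] [FiniteDimensional K F] (α : 𝔇 →ₗ[K] E) (β : 𝔇 →ₗ[K] F)
    (hα : Function.Surjective α) (h : ∀ D, β D = 0 → α D = 0) :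
    finrank K E ≤ finrank K (LinearMap.range β) := by
  have hker : LinearMap.ker β.rangeRestrict ≤ LinearMap.ker α := fun D hD => by
    rw [LinearMap.ker_rangeRestrict] at hD
    exact h D hD
  obtain ⟨s, hs⟩ := LinearMap.exists_rightInverse_of_surjective β.rangeRestrict
    (LinearMap.range_rangeRestrict β)
  refine LinearMap.finrank_le_finrank_of_surjective (f := α ∘ₗ s) fun x => ?_
  obtain ⟨D, rfl⟩ := hα x
  refine ⟨β.rangeRestrict D, ?_⟩
  have h1 : D - s (β.rangeRestrict D) ∈ LinearMap.ker β.rangeRestrict := by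
    rw [LinearMap.mem_ker, map_sub, sub_eq_zero]
    exact (LinearMap.congr_fun hs _).symm
  have h2 := hker h1
  rw [LinearMap.mem_ker, map_sub, sub_eq_zero] at h2
  exact h2.symm

end Action

section InfinitesimalAction

variable {V : Type*} [AddCommGroup V] [Module ℂ V]

theorem wedge3_self_left (x y : V) : wedge3 x x y = 0 :=
  (exteriorPower.ιMulti ℂ 3).map_eq_zero_of_eq ![x, x, y] (i := 0) (j := 1) rfl (by decide)

theorem wedge3_self_right (x y : V) : wedge3 x y y = 0 :=
  (exteriorPower.ιMulti ℂ 3).map_eq_zero_of_eq ![x, y, y] (i := 1) (j := 2) rfl (by decide)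

theorem wedge3_self_outer (x y : V) : wedge3 x y x = 0 :=
  (exteriorPower.ιMulti ℂ 3).map_eq_zero_of_eq ![x, y, x] (i := 0) (j := 2) rfl (by decide)

theorem wedge3_swap_left (x y z : V) : wedge3 x y z = -wedge3 y x z := by
  have h := wedge3_self_left (x + y) z
  simp only [map_add, LinearMap.add_apply, wedge3_self_left, zero_add, add_zero] at h
  exact eq_neg_of_add_eq_zero_right h

theorem wedge3_swap_right (x y z : V) : wedge3 x y z = -wedge3 x z y := by
  have h := wedge3_self_right x (y + z)
  simp only [map_add, LinearMap.add_apply, wedge3_self_right, zero_add, add_zero] at h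
  exact eq_neg_of_add_eq_zero_right h

/-- The action of an endomorphism of `V` on `⋀³ V` as a derivation. -/
noncomputable def derivForm (g : V →ₗ[ℂ] V) : ⋀[ℂ]^3 V →ₗ[ℂ] ⋀[ℂ]^3 V :=
  exteriorPower.alternatingMapLinearEquiv
    { ((exteriorPower.ιMulti ℂ 3).toMultilinearMap.compLinearMap ![g, .id, .id] +
        (exteriorPower.ιMulti ℂ 3).toMultilinearMap.compLinearMap ![.id, g, .id] +
        (exteriorPower.ιMulti ℂ 3).toMultilinearMap.compLinearMap ![.id, .id, g]) with
      map_eq_zero_of_eq' := by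
        intro e i j hij hne
        have key : ∀ x y z : V, (x = y ∨ y = z ∨ x = z) →
            wedge3 (g x) y z + wedge3 x (g y) z + wedge3 x y (g z) = 0 := by
          rintro x y z (rfl | rfl | rfl)
          · rw [wedge3_swap_left (g x) x, wedge3_self_left]
            simp
          · rw [wedge3_swap_right x (g y) y, wedge3_self_right]
            simp
          · rw [wedge3_swap_right (g x) y x, wedge3_swap_left (g x) x y,
              wedge3_swap_right x y (g x), wedge3_self_outer]
            simp
        have h := key (e 0) (e 1) (e 2) (by
          fin_cases i <;> fin_cases j <;> simp_all)
        refine Eq.trans ?_ h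
        simp only [wedge3_apply]
        change exteriorPower.ιMulti ℂ 3 _ + exteriorPower.ιMulti ℂ 3 _ +
          exteriorPower.ιMulti ℂ 3 _ = _
        congr 3 <;> ext i : 1 <;> fin_cases i <;> rfl }

theorem derivForm_wedge3 (g : V →ₗ[ℂ] V) (x y z : V) :
    derivForm g (wedge3 x y z) = wedge3 (g x) y z + wedge3 x (g y) z + wedge3 x y (g z) := by
  rw [derivForm, wedge3_apply, exteriorPower.alternatingMapLinearEquiv_apply_ιMulti]
  change exteriorPower.ιMulti ℂ 3 _ + exteriorPower.ιMulti ℂ 3 _ +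
    exteriorPower.ιMulti ℂ 3 _ = _
  simp only [wedge3_apply]
  congr 3 <;> ext i : 1 <;> fin_cases i <;> rfl

end InfinitesimalAction

/-! ### First derivatives of `p + p'` and the dimension of `Z`. -/

section Tangent

variable {V : Type*} [AddCommGroup V] [Module ℂ V]
  {𝔇 : Type*} [AddCommGroup 𝔇] [Module ℂ 𝔇] {Z : Submodule ℂ (⋀[ℂ]^3 V)}

/-- The derivatives of a 3-form. -/
noncomputable def LeibnizAction.derivatives (A : LeibnizAction 𝔇 Z) (z : ⋀[ℂ]^3 V) :
    𝔇 →ₗ[ℂ] ⋀[ℂ]^3 V :=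
  LinearMap.proj z ∘ₗ A.onForms

theorem LeibnizAction.range_derivatives_le (A : LeibnizAction 𝔇 Z) {z : ⋀[ℂ]^3 V} (hz : z ∈ Z) :
    LinearMap.range (A.derivatives z) ≤ Z := by
  rintro _ ⟨D, rfl⟩
  exact A.map_mem D z hz

variable [FiniteDimensional ℂ V]

/-- If `p + f₀ ∧ f₁ ∧ f₂ ∈ Z`, where `p` moves freely on the Grassmannian, then `Z` is at least as
large as the image of the tangent space at `p` under any linear map which kills the tangent space
at `f₀ ∧ f₁ ∧ f₂`. -/
theorem LeibnizAction.le_finrank_range_derivatives (A : LeibnizAction 𝔇 Z)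
    {p : ⋀[ℂ]^3 V} (f₀ f₁ f₂ : V)
    (hgen : ∀ g : V →ₗ[ℂ] V, ∃ D, A.onForms D p = derivForm g p)
    {m : ℕ} (φ : ⋀[ℂ]^3 V →ₗ[ℂ] (Fin m → ℂ))
    (hφ : ∀ t, ∃ g : V →ₗ[ℂ] V, φ (derivForm g p) = t)
    (hφ' : ∀ x y z, φ (wedge3 x f₁ f₂ + wedge3 f₀ y f₂ + wedge3 f₀ f₁ z) = 0) :
    m ≤ finrank ℂ (LinearMap.range (A.derivatives (p + wedge3 f₀ f₁ f₂))) := by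
  have h := finrank_le_finrank_range_of_ker_le (φ ∘ₗ LinearMap.proj p ∘ₗ A.onForms)
    (A.derivatives (p + wedge3 f₀ f₁ f₂)) ?_ ?_
  · rwa [finrank_fin_fun] at h
  · intro t
    obtain ⟨g, hg⟩ := hφ t
    obtain ⟨D, hD⟩ := hgen g
    exact ⟨D, by rw [← hg, ← hD]; rfl⟩
  · intro D hD
    have h0 : A.onForms D (p + wedge3 f₀ f₁ f₂) = 0 := hD
    rw [A.onForms_add, A.leibniz] at h0
    change φ (A.onForms D p) = 0
    rw [eq_neg_of_add_eq_zero_left h0, map_neg, hφ', neg_zero]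

/-- The tangent space at `b₀ ∧ b₁ ∧ b₂` involves index triples with at least two entries in `{0, 1,
2}`, and that at `b₃ ∧ b₄ ∧ b₅` only triples with at most one. Seven of the former coefficients
already exceed `dim Z = 6`. -/
theorem LeibnizAction.false_of_disjoint (A : LeibnizAction 𝔇 Z) (hdim : finrank ℂ Z = 6)
    (B : Basis (Fin 6) ℂ V) (hz : wedge3 (B 0) (B 1) (B 2) + wedge3 (B 3) (B 4) (B 5) ∈ Z)
    (hgen : ∀ g : V →ₗ[ℂ] V, ∃ D, A.onForms D (wedge3 (B 0) (B 1) (B 2)) =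
      derivForm g (wedge3 (B 0) (B 1) (B 2))) : False := by
  have h := A.le_finrank_range_derivatives (B 3) (B 4) (B 5) hgen
    (LinearMap.pi ![coef B 0 1 3, coef B 0 1 4,
    coef B 0 1 5, coef B 0 2 3, coef B 0 2 4, coef B 0 2 5, coef B 1 2 3]) ?_ ?_
  · have h' := Submodule.finrank_mono (A.range_derivatives_le hz)
    omega
  · intro t
    refine ⟨B.constr ℂ ![t 6 • B 3, -(t 3 • B 3 + t 4 • B 4 + t 5 • B 5),
      t 0 • B 3 + t 1 • B 4 + t 2 • B 5, 0, 0, 0], ?_⟩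
    ext i
    rw [derivForm_wedge3]
    fin_cases i <;>
    simp [coef_wedge3]
  · intro x y z
    ext i
    fin_cases i <;>
    simp [coef_wedge3]

/-- Exactly six index triples have at least two entries in `{0, 1, 2}` and at most one in `{0, 3,
4}`. Hence the derivatives, which lie in `Z`, span a space of dimension at least 6 and fill `Z`. -/
theorem LeibnizAction.exists_derivative_eq (A : LeibnizAction 𝔇 Z) (hdim : finrank ℂ Z = 6)
    (B : Basis (Fin 6) ℂ V) (hz : wedge3 (B 0) (B 1) (B 2) + wedge3 (B 0) (B 3) (B 4) ∈ Z)
    (hgen : ∀ g : V →ₗ[ℂ] V, ∃ D, A.onForms D (wedge3 (B 0) (B 1) (B 2)) =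
      derivForm g (wedge3 (B 0) (B 1) (B 2))) {u : ⋀[ℂ]^3 V} (hu : u ∈ Z) :
    ∃ D, A.onForms D (wedge3 (B 0) (B 1) (B 2) + wedge3 (B 0) (B 3) (B 4)) = u := by
  have h := A.le_finrank_range_derivatives (B 0) (B 3) (B 4) hgen
    (LinearMap.pi ![coef B 0 1 2, coef B 0 1 5,
    coef B 0 2 5, coef B 1 2 3, coef B 1 2 4, coef B 1 2 5]) ?_ ?_
  · have heq := Submodule.eq_of_le_of_finrank_le (A.range_derivatives_le hz) (hdim.le.trans h)
    rw [← heq] at hu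
    exact hu
  · intro t
    refine ⟨B.constr ℂ ![t 0 • B 0 + t 3 • B 3 + t 4 • B 4 + t 5 • B 5, -(t 2 • B 5), t 1 • B 5,
      0, 0, 0], ?_⟩
    ext i
    rw [derivForm_wedge3]
    fin_cases i <;>
    simp [coef_wedge3]
  · intro x y z
    ext i
    fin_cases i <;>
    simp [coef_wedge3]

end Tangent

/-! ### Relations from first and second derivatives. -/

section SecondOrder

variable {V : Type*} [AddCommGroup V] [Module ℂ V]

/-- For `u = x ∧ (b₁ ∧ b₂ + b₃ ∧ b₄) + b₀ ∧ η` this is the vector of coordinates of `x` modulo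
`b₀`. -/
noncomputable def leadingCoords (B : Basis (Fin 6) ℂ V) : ⋀[ℂ]^3 V →ₗ[ℂ] (Fin 6 → ℂ) :=
  LinearMap.pi ![0, coef B 1 3 4, coef B 2 3 4, coef B 1 2 3, coef B 1 2 4, coef B 1 2 5]

/-- The coefficients of the polarization of `x ∧ η`, for `u = x ∧ ω + b₀ ∧ η` as in
`leadingCoords`. -/
noncomputable def mixedCoef (B : Basis (Fin 6) ℂ V) (i j k : Fin 6) (u u' : ⋀[ℂ]^3 V) : ℂ :=
  leadingCoords B u i * coef B 0 j k u' - leadingCoords B u j * coef B 0 i k u' +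
    leadingCoords B u k * coef B 0 i j u' +
  (leadingCoords B u' i * coef B 0 j k u - leadingCoords B u' j * coef B 0 i k u +
    leadingCoords B u' k * coef B 0 i j u)

variable {𝔇 : Type*} [AddCommGroup 𝔇] [Module ℂ 𝔇] {Z : Submodule ℂ (⋀[ℂ]^3 V)}

/-- Coefficients without the index 0 see only `x ∧ ω` in `x ∧ ω + b₀ ∧ η`; these are the five
equations of `V ∧ ω` modulo `b₀`. -/
theorem LeibnizAction.coef_eq_zero (A : LeibnizAction 𝔇 Z)
    (B : Basis (Fin 6) ℂ V)
    (hsurj : ∀ u ∈ Z, ∃ D,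
      A.onForms D (wedge3 (B 0) (B 1) (B 2) + wedge3 (B 0) (B 3) (B 4)) = u)
    {u : ⋀[ℂ]^3 V} (hu : u ∈ Z) :
    coef B 1 3 5 u = 0 ∧ coef B 1 4 5 u = 0 ∧ coef B 2 3 5 u = 0 ∧ coef B 2 4 5 u = 0 ∧
      coef B 1 2 5 u = coef B 3 4 5 u := by
  obtain ⟨D, rfl⟩ := hsurj u hu
  rw [A.onForms_add, A.leibniz, A.leibniz]
  refine ⟨?_, ?_, ?_, ?_, ?_⟩ <;>
  simp [coef_wedge3]

/-- Expand `D' D (b₀ ∧ ω) ∈ Z`. The term `D' D b₀ ∧ ω` satisfies the five equations, `b₀ ∧ D' D ω`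
vanishes modulo `b₀`, and the cross terms `D b₀ ∧ D' ω + D' b₀ ∧ D ω` remain. -/
theorem LeibnizAction.mixedCoef_eq_zero (A : LeibnizAction 𝔇 Z)
    (B : Basis (Fin 6) ℂ V)
    (hz : wedge3 (B 0) (B 1) (B 2) + wedge3 (B 0) (B 3) (B 4) ∈ Z)
    (hsurj : ∀ u ∈ Z, ∃ D,
      A.onForms D (wedge3 (B 0) (B 1) (B 2) + wedge3 (B 0) (B 3) (B 4)) = u)
    {u u' : ⋀[ℂ]^3 V} (hu : u ∈ Z) (hu' : u' ∈ Z) :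
    mixedCoef B 1 3 5 u u' = 0 ∧ mixedCoef B 1 4 5 u u' = 0 ∧ mixedCoef B 2 3 5 u u' = 0 ∧
      mixedCoef B 2 4 5 u u' = 0 ∧ mixedCoef B 1 2 5 u u' = mixedCoef B 3 4 5 u u' := by
  obtain ⟨D, hD⟩ := hsurj u hu
  obtain ⟨D', hD'⟩ := hsurj u' hu'
  have hw := A.map_mem D' _ (A.map_mem D _ hz)
  obtain ⟨h1, h2, h3, h4, h5⟩ := A.coef_eq_zero B hsurj hw
  rw [← hD, ← hD']
  rw [A.onForms_add, A.leibniz, A.leibniz] at h1 h2 h3 h4 h5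
  simp only [A.onForms_add, A.leibniz, mixedCoef, leadingCoords, LinearMap.pi_apply, map_add]
    at h1 h2 h3 h4 h5 ⊢
  simp [coef_wedge3] at h1 h2 h3 h4 h5 ⊢
  refine ⟨?_, ?_, ?_, ?_, ?_⟩
  · linear_combination h1
  · linear_combination h2
  · linear_combination h3
  · linear_combination h4
  · linear_combination h5

end SecondOrder

/-! ### The kernel of the leading coordinates on `Z`. -/

section Classification

variable {V : Type*} [AddCommGroup V] [Module ℂ V]

theorem ext_coef_six (B : Basis (Fin 6) ℂ V) {s t : ⋀[ℂ]^3 V}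
    (h012 : coef B 0 1 2 s = coef B 0 1 2 t) (h013 : coef B 0 1 3 s = coef B 0 1 3 t)
    (h014 : coef B 0 1 4 s = coef B 0 1 4 t) (h015 : coef B 0 1 5 s = coef B 0 1 5 t)
    (h023 : coef B 0 2 3 s = coef B 0 2 3 t) (h024 : coef B 0 2 4 s = coef B 0 2 4 t)
    (h025 : coef B 0 2 5 s = coef B 0 2 5 t) (h034 : coef B 0 3 4 s = coef B 0 3 4 t)
    (h035 : coef B 0 3 5 s = coef B 0 3 5 t) (h045 : coef B 0 4 5 s = coef B 0 4 5 t)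
    (h123 : coef B 1 2 3 s = coef B 1 2 3 t) (h124 : coef B 1 2 4 s = coef B 1 2 4 t)
    (h125 : coef B 1 2 5 s = coef B 1 2 5 t) (h134 : coef B 1 3 4 s = coef B 1 3 4 t)
    (h135 : coef B 1 3 5 s = coef B 1 3 5 t) (h145 : coef B 1 4 5 s = coef B 1 4 5 t)
    (h234 : coef B 2 3 4 s = coef B 2 3 4 t) (h235 : coef B 2 3 5 s = coef B 2 3 5 t)
    (h245 : coef B 2 4 5 s = coef B 2 4 5 t) (h345 : coef B 3 4 5 s = coef B 3 4 5 t) :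
    s = t := by
  refine ext_coef B fun i j k hij hjk => ?_
  fin_cases i <;> fin_cases j <;> first | (exfalso; revert hij; decide) | skip
  all_goals fin_cases k <;> first | (exfalso; revert hjk; decide) | assumption

theorem repr_equivFun_symm {ι : Type*} [Fintype ι] (b : Basis ι ℂ V) (f : ι → ℂ) (i : ι) :
    b.repr (b.equivFun.symm f) i = f i := by
  rw [← b.equivFun_apply, LinearEquiv.apply_symm_apply]

theorem exists_mem_apply_eq_of_ker_le_span {K W E : Type*} [Field K] [AddCommGroup W] [Module K W]
    [AddCommGroup E] [Module K E] [FiniteDimensional K W] [FiniteDimensional K E]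
    (Z : Submodule K W) (f : W →ₗ[K] E) (w : W)
    (hker : ∀ u ∈ Z, f u = 0 → ∃ r : K, u = r • w) (hdim : finrank K Z = finrank K E + 1) (t : E) :
    ∃ u ∈ Z, f u = t := by
  have hk : finrank K (LinearMap.ker (f.domRestrict Z)) ≤ 1 := by
    refine (LinearMap.finrank_le_finrank_of_injective
      (f := (Z.subtype ∘ₗ (LinearMap.ker (f.domRestrict Z)).subtype).codRestrict
        (Submodule.span K {w}) ?_) ?_).trans ((finrank_span_le_card _).trans ?_)
    · rintro ⟨u, hu⟩
      obtain ⟨r, hr⟩ := hker u.1 u.2 hu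
      exact Submodule.mem_span_singleton.2 ⟨r, hr.symm⟩
    · intro u u' h
      have h2 := congrArg Subtype.val h
      exact Subtype.ext (Subtype.ext h2)
    · simp
  have h := LinearMap.finrank_range_add_finrank_ker (f.domRestrict Z)
  have htop : LinearMap.range (f.domRestrict Z) = ⊤ := by
    apply Submodule.eq_top_of_finrank_eq
    have := Submodule.finrank_le (LinearMap.range (f.domRestrict Z))
    omega
  obtain ⟨u, hu⟩ := LinearMap.range_eq_top.1 htop t
  exact ⟨u.1, u.2, hu⟩

variable {B : Basis (Fin 6) ℂ V} {Z : Submodule ℂ (⋀[ℂ]^3 V)}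

-- Here `u = b₀ ∧ η`. For `x` the leading vector of `u₀`, the mixed relation says `x ∧ η = R b₅ ∧ ω
-- + …` in `V ∧ ω` modulo `b₀`. Contracting with the coordinate `b₅*`, which kills `ω`, gives `x₅ η
-- - R ω = w ∧ x`. So `x₅ u - R b₀ ∧ ω` is decomposable and lies in `Z`, hence is zero.
set_option maxHeartbeats 1000000 in
theorem exists_eq_smul_of_leadingCoords_eq_zero
    (hGr : ∀ x y z, wedge3 x y z ∈ Z → wedge3 x y z = 0)
    (hz : wedge3 (B 0) (B 1) (B 2) + wedge3 (B 0) (B 3) (B 4) ∈ Z)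
    (hC : ∀ u ∈ Z, coef B 1 3 5 u = 0 ∧ coef B 1 4 5 u = 0 ∧ coef B 2 3 5 u = 0 ∧
      coef B 2 4 5 u = 0 ∧ coef B 1 2 5 u = coef B 3 4 5 u)
    (hP : ∀ u ∈ Z, ∀ u' ∈ Z, mixedCoef B 1 3 5 u u' = 0 ∧ mixedCoef B 1 4 5 u u' = 0 ∧
      mixedCoef B 2 3 5 u u' = 0 ∧ mixedCoef B 2 4 5 u u' = 0 ∧
      mixedCoef B 1 2 5 u u' = mixedCoef B 3 4 5 u u')
    {u₀ : ⋀[ℂ]^3 V} (hu₀ : u₀ ∈ Z) (h₀ : coef B 1 2 5 u₀ ≠ 0)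
    {u : ⋀[ℂ]^3 V} (hu : u ∈ Z) (h : leadingCoords B u = 0) :
    ∃ r : ℂ, u = r • (wedge3 (B 0) (B 1) (B 2) + wedge3 (B 0) (B 3) (B 4)) := by
  obtain ⟨p1, p2, p3, p4, p5⟩ := hP u₀ hu₀ u hu
  obtain ⟨c1, c2, c3, c4, c5⟩ := hC u hu
  have d1 : coef B 1 3 4 u = 0 := congrFun h 1
  have d2 : coef B 2 3 4 u = 0 := congrFun h 2
  have d3 : coef B 1 2 3 u = 0 := congrFun h 3
  have d4 : coef B 1 2 4 u = 0 := congrFun h 4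
  have d5 : coef B 1 2 5 u = 0 := congrFun h 5
  obtain ⟨x, hx⟩ : ∃ x, x = leadingCoords B u₀ := ⟨_, rfl⟩
  have h₀' : x 5 ≠ 0 := by rwa [hx]
  simp only [mixedCoef, h, Pi.zero_apply, zero_mul, sub_zero, add_zero, ← hx] at p1 p2 p3 p4 p5
  -- `R` is the coefficient of `x ∧ η` at `b₁ ∧ b₂ ∧ b₅`.
  set R : ℂ := x 5 * coef B 0 1 2 u + x 1 * coef B 0 2 5 u - x 2 * coef B 0 1 5 u with hR
  have key : x 5 • u - R • (wedge3 (B 0) (B 1) (B 2) + wedge3 (B 0) (B 3) (B 4)) =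
      wedge3 (B 0) (B.equivFun.symm
        ![0, coef B 0 1 5 u, coef B 0 2 5 u, coef B 0 3 5 u, coef B 0 4 5 u, 0])
        (B.equivFun.symm x) := by
    apply ext_coef_six B <;> rw [map_sub, map_smul, map_smul, map_add] <;>
      simp [coef_wedge3, repr_equivFun_symm, -Basis.equivFun_symm_apply, c1, c2, c3, c4, ← c5, d1,
        d2, d3, d4, d5, hR]
    · ring
    · linear_combination p1
    · linear_combination p2
    · ring
    · linear_combination p3
    · linear_combination p4
    · ring
    · linear_combination -p5
    · ring
    · ring
  have hmem := Z.sub_mem (Z.smul_mem (x 5) hu) (Z.smul_mem R hz)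
  rw [key] at hmem
  rw [hGr _ _ _ hmem, sub_eq_zero] at key
  refine ⟨(x 5)⁻¹ * R, ?_⟩
  rw [mul_smul, ← key, smul_smul, inv_mul_cancel₀ h₀', one_smul]

end Classification

/-! ### Solving the bilinear relations for the 2-form. -/

section Structure

variable {V : Type*} [AddCommGroup V] [Module ℂ V]

variable {B : Basis (Fin 6) ℂ V} {Z : Submodule ℂ (⋀[ℂ]^3 V)}

/-- The 3-form `x ∧ (b₁ ∧ b₂ + b₃ ∧ b₄ + b₀ ∧ y)`. -/
noncomputable def sigmaWedge (B : Basis (Fin 6) ℂ V) (y : V) : V →ₗ[ℂ] ⋀[ℂ]^3 V :=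
  (wedge3.flip (B 1)).flip (B 2) + (wedge3.flip (B 3)).flip (B 4) + (wedge3.flip (B 0)).flip y

theorem sigmaWedge_apply (y x : V) : sigmaWedge B y x =
    wedge3 x (B 1) (B 2) + wedge3 x (B 3) (B 4) + wedge3 x (B 0) y := rfl

-- Lift `b₁, …, b₅` to elements `uᵢ ∈ Z` with these leading vectors. The mixed relations among them
-- determine each `uᵢ`, up to a multiple of `b₀ ∧ ω`, as `bᵢ ∧ (ω + b₀ ∧ y)` with one common `y`.
set_option maxHeartbeats 2000000 in
theorem exists_sigmaWedge_mem
    (hz : wedge3 (B 0) (B 1) (B 2) + wedge3 (B 0) (B 3) (B 4) ∈ Z)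
    (hC : ∀ u ∈ Z, coef B 1 3 5 u = 0 ∧ coef B 1 4 5 u = 0 ∧ coef B 2 3 5 u = 0 ∧
      coef B 2 4 5 u = 0 ∧ coef B 1 2 5 u = coef B 3 4 5 u)
    (hP : ∀ u ∈ Z, ∀ u' ∈ Z, mixedCoef B 1 3 5 u u' = 0 ∧ mixedCoef B 1 4 5 u u' = 0 ∧
      mixedCoef B 2 3 5 u u' = 0 ∧ mixedCoef B 2 4 5 u u' = 0 ∧
      mixedCoef B 1 2 5 u u' = mixedCoef B 3 4 5 u u')
    (hsurj : ∀ t : Fin 6 → ℂ, t 0 = 0 → ∃ u ∈ Z, leadingCoords B u = t) :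
    ∃ y, ∀ x, sigmaWedge B y x ∈ Z := by
  obtain ⟨u1, m1, l1⟩ := hsurj ![0, 1, 0, 0, 0, 0] rfl
  obtain ⟨u2, m2, l2⟩ := hsurj ![0, 0, 1, 0, 0, 0] rfl
  obtain ⟨u3, m3, l3⟩ := hsurj ![0, 0, 0, 1, 0, 0] rfl
  obtain ⟨u4, m4, l4⟩ := hsurj ![0, 0, 0, 0, 1, 0] rfl
  obtain ⟨u5, m5, l5⟩ := hsurj ![0, 0, 0, 0, 0, 1] rfl
  have p55 := hP u5 m5 u5 m5
  have p51 := hP u5 m5 u1 m1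
  have p52 := hP u5 m5 u2 m2
  have p53 := hP u5 m5 u3 m3
  have p54 := hP u5 m5 u4 m4
  have p11 := hP u1 m1 u1 m1
  have p12 := hP u1 m1 u2 m2
  have p13 := hP u1 m1 u3 m3
  have p14 := hP u1 m1 u4 m4
  have p22 := hP u2 m2 u2 m2
  have p33 := hP u3 m3 u3 m3
  have p44 := hP u4 m4 u4 m4
  simp [mixedCoef, l1, l2, l3, l4, l5] at p55 p51 p52 p53 p54 p11 p12 p13 p14 p22 p33 p44
  obtain ⟨c11, c12, c13, c14, c15⟩ := hC u1 m1
  obtain ⟨c21, c22, c23, c24, c25⟩ := hC u2 m2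
  obtain ⟨c31, c32, c33, c34, c35⟩ := hC u3 m3
  obtain ⟨c41, c42, c43, c44, c45⟩ := hC u4 m4
  obtain ⟨c51, c52, c53, c54, c55⟩ := hC u5 m5
  have d11 : coef B 1 3 4 u1 = 1 := congrFun l1 1
  have d12 : coef B 2 3 4 u1 = 0 := congrFun l1 2
  have d13 : coef B 1 2 3 u1 = 0 := congrFun l1 3
  have d14 : coef B 1 2 4 u1 = 0 := congrFun l1 4
  have d15 : coef B 1 2 5 u1 = 0 := congrFun l1 5
  have d21 : coef B 1 3 4 u2 = 0 := congrFun l2 1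
  have d22 : coef B 2 3 4 u2 = 1 := congrFun l2 2
  have d23 : coef B 1 2 3 u2 = 0 := congrFun l2 3
  have d24 : coef B 1 2 4 u2 = 0 := congrFun l2 4
  have d25 : coef B 1 2 5 u2 = 0 := congrFun l2 5
  have d31 : coef B 1 3 4 u3 = 0 := congrFun l3 1
  have d32 : coef B 2 3 4 u3 = 0 := congrFun l3 2
  have d33 : coef B 1 2 3 u3 = 1 := congrFun l3 3
  have d34 : coef B 1 2 4 u3 = 0 := congrFun l3 4
  have d35 : coef B 1 2 5 u3 = 0 := congrFun l3 5
  have d41 : coef B 1 3 4 u4 = 0 := congrFun l4 1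
  have d42 : coef B 2 3 4 u4 = 0 := congrFun l4 2
  have d43 : coef B 1 2 3 u4 = 0 := congrFun l4 3
  have d44 : coef B 1 2 4 u4 = 1 := congrFun l4 4
  have d45 : coef B 1 2 5 u4 = 0 := congrFun l4 5
  have d51 : coef B 1 3 4 u5 = 0 := congrFun l5 1
  have d52 : coef B 2 3 4 u5 = 0 := congrFun l5 2
  have d53 : coef B 1 2 3 u5 = 0 := congrFun l5 3
  have d54 : coef B 1 2 4 u5 = 0 := congrFun l5 4
  have d55 : coef B 1 2 5 u5 = 1 := congrFun l5 5
  obtain ⟨p55_1, p55_2, p55_3, p55_4, p55_5⟩ := p55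
  obtain ⟨p51_1, p51_2, p51_3, p51_4, p51_5⟩ := p51
  obtain ⟨p52_1, p52_2, p52_3, p52_4, p52_5⟩ := p52
  obtain ⟨p53_1, p53_2, p53_3, p53_4, p53_5⟩ := p53
  obtain ⟨p54_1, p54_2, p54_3, p54_4, p54_5⟩ := p54
  obtain ⟨p11_1, p11_2, p11_3⟩ := p11
  obtain ⟨p12_1, p12_2, p12_3, p12_4, p12_5⟩ := p12
  obtain ⟨p13_1, p13_2, p13_3, p13_4⟩ := p13
  obtain ⟨p14_1, p14_2, p14_3, p14_4⟩ := p14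
  obtain ⟨p22_1, p22_2, p22_3⟩ := p22
  obtain ⟨p33_1, p33_2, p33_3⟩ := p33
  obtain ⟨p44_1, p44_2, p44_3⟩ := p44
  have f512 : coef B 0 3 4 u5 = coef B 0 1 2 u5 := by
    linear_combination (-1 / 2 : ℂ) * p55_5
  have f113 : coef B 0 1 3 u1 = -coef B 0 3 5 u5 := by
    linear_combination p51_1
  have f114 : coef B 0 1 4 u1 = -coef B 0 4 5 u5 := by
    linear_combination p51_2
  have f112 : coef B 0 1 2 u1 = coef B 0 3 4 u1 - coef B 0 2 5 u5 := by
    linear_combination p51_5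
  have f223 : coef B 0 2 3 u2 = -coef B 0 3 5 u5 := by
    linear_combination p52_3
  have f224 : coef B 0 2 4 u2 = -coef B 0 4 5 u5 := by
    linear_combination p52_4
  have f212 : coef B 0 1 2 u2 = coef B 0 3 4 u2 + coef B 0 1 5 u5 := by
    linear_combination p52_5
  have f225 : coef B 0 2 5 u2 = coef B 0 1 5 u1 := by
    linear_combination p12_5
  have f313 : coef B 0 1 3 u3 = coef B 0 1 5 u5 := by
    linear_combination p53_1
  have f323 : coef B 0 2 3 u3 = coef B 0 2 5 u5 := by
    linear_combination p53_3
  have f334 : coef B 0 3 4 u3 = coef B 0 1 2 u3 - coef B 0 4 5 u5 := by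
    linear_combination -p53_5
  have f335 : coef B 0 3 5 u3 = coef B 0 1 5 u1 := by
    linear_combination p13_1
  have f414 : coef B 0 1 4 u4 = coef B 0 1 5 u5 := by
    linear_combination p54_2
  have f424 : coef B 0 2 4 u4 = coef B 0 2 5 u5 := by
    linear_combination p54_4
  have f434 : coef B 0 3 4 u4 = coef B 0 1 2 u4 + coef B 0 3 5 u5 := by
    linear_combination -p54_5
  have f445 : coef B 0 4 5 u4 = coef B 0 1 5 u1 := by
    linear_combination p14_2
  -- Since `bᵢ ∧ b₀ ∧ y = -b₀ ∧ bᵢ ∧ y`, the coordinates `y₁, …, y₄` are read off from `u₅` and `y₅`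
  -- from `u₁`; `y₀` is irrelevant.
  set y : V := B.equivFun.symm ![0, coef B 0 1 5 u5, coef B 0 2 5 u5, coef B 0 3 5 u5,
    coef B 0 4 5 u5, -coef B 0 1 5 u1] with hy
  set z := wedge3 (B 0) (B 1) (B 2) + wedge3 (B 0) (B 3) (B 4) with hzdef
  have w1 : sigmaWedge B y (B 1) = u1 - (coef B 0 3 4 u1) • z := by
    rw [sigmaWedge_apply, hzdef]
    apply ext_coef_six B <;> rw [map_add, map_add, map_sub, map_smul, map_add] <;>
      simp [coef_wedge3, hy, repr_equivFun_symm, -Basis.equivFun_symm_apply, c11, c12,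
        c13, c14, ← c15, d11, d12, d13, d14, d15, p51_3, p51_4, p11_1, p11_2, p11_3, f113, f114, f112]
  have w2 : sigmaWedge B y (B 2) = u2 - (coef B 0 3 4 u2) • z := by
    rw [sigmaWedge_apply, hzdef]
    apply ext_coef_six B <;> rw [map_add, map_add, map_sub, map_smul, map_add] <;>
      simp [coef_wedge3, hy, repr_equivFun_symm, -Basis.equivFun_symm_apply, c21, c22,
        c23, c24, ← c25, d21, d22, d23, d24, d25, p52_1, p52_2, p22_1, p22_2, p22_3, f223, f224, f212, f225]
  have w3 : sigmaWedge B y (B 3) = u3 - (coef B 0 1 2 u3) • z := by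
    rw [sigmaWedge_apply, hzdef]
    apply ext_coef_six B <;> rw [map_add, map_add, map_sub, map_smul, map_add] <;>
      simp [coef_wedge3, hy, repr_equivFun_symm, -Basis.equivFun_symm_apply, c31, c32,
        c33, c34, ← c35, d31, d32, d33, d34, d35, p53_2, p53_4, p33_1, p33_2, p13_2, f313, f323, f334, f335]
  have w4 : sigmaWedge B y (B 4) = u4 - (coef B 0 1 2 u4) • z := by
    rw [sigmaWedge_apply, hzdef]
    apply ext_coef_six B <;> rw [map_add, map_add, map_sub, map_smul, map_add] <;>
      simp [coef_wedge3, hy, repr_equivFun_symm, -Basis.equivFun_symm_apply, c41, c42,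
        c43, c44, ← c45, d41, d42, d43, d44, d45, p54_1, p54_3, p44_1, p44_2, p14_1, f414, f424, f434, f445]
  have w5 : sigmaWedge B y (B 5) = u5 - (coef B 0 1 2 u5) • z := by
    rw [sigmaWedge_apply, hzdef]
    apply ext_coef_six B <;> rw [map_add, map_add, map_sub, map_smul, map_add] <;>
      simp [coef_wedge3, hy, repr_equivFun_symm, -Basis.equivFun_symm_apply, c51, c52,
        c53, c54, ← c55, d51, d52, d53, d54, d55, p55_1, p55_2, p55_3, p55_4, f512]
  have w0 : sigmaWedge B y (B 0) = z := by
    rw [sigmaWedge_apply, wedge3_self_left, add_zero]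
  refine ⟨y, fun x => ?_⟩
  rw [← B.sum_repr x, map_sum]
  refine Z.sum_mem fun i _ => ?_
  rw [map_smul]
  refine Z.smul_mem _ ?_
  fin_cases i
  · exact w0 ▸ hz
  · exact w1 ▸ Z.sub_mem m1 (Z.smul_mem _ hz)
  · exact w2 ▸ Z.sub_mem m2 (Z.smul_mem _ hz)
  · exact w3 ▸ Z.sub_mem m3 (Z.smul_mem _ hz)
  · exact w4 ▸ Z.sub_mem m4 (Z.smul_mem _ hz)
  · exact w5 ▸ Z.sub_mem m5 (Z.smul_mem _ hz)

end Structure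

/-! ### Explicit 2-forms and their wedge subspaces. -/

section TwoForms

variable {V : Type*} [AddCommGroup V] [Module ℂ V]

/-- The 2-form `x₁ ∧ y₁ + x₂ ∧ y₂ + x₃ ∧ y₃`. -/
noncomputable def pairSum (x₁ y₁ x₂ y₂ x₃ y₃ : V) : ⋀[ℂ]^2 V :=
  exteriorPower.ιMulti ℂ 2 ![x₁, y₁] + exteriorPower.ιMulti ℂ 2 ![x₂, y₂] +
    exteriorPower.ιMulti ℂ 2 ![x₃, y₃]

theorem dualForm_ιMulti (x y : V) (f g : Dual ℂ V) :
    dualForm (exteriorPower.ιMulti ℂ 2 ![x, y]) f g = f x * g y - g x * f y := by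
  rw [dualForm, exteriorPower.pairingDual_ιMulti_ιMulti, Matrix.det_fin_two]
  simp

theorem dualForm_pairSum (x₁ y₁ x₂ y₂ x₃ y₃ : V) (f g : Dual ℂ V) :
    dualForm (pairSum x₁ y₁ x₂ y₂ x₃ y₃) f g = (f x₁ * g y₁ - g x₁ * f y₁) +
      (f x₂ * g y₂ - g x₂ * f y₂) + (f x₃ * g y₃ - g x₃ * f y₃) := by
  rw [← dualForm_ιMulti, ← dualForm_ιMulti, ← dualForm_ιMulti]
  simp only [dualForm, pairSum, map_add]

theorem mem_wedgeSubspace_pairSum {x₁ y₁ x₂ y₂ x₃ y₃ : V} {t : ⋀[ℂ]^3 V} :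
    t ∈ wedgeSubspace 3 (pairSum x₁ y₁ x₂ y₂ x₃ y₃) ↔
      ∃ x, t = wedge3 x x₁ y₁ + wedge3 x x₂ y₂ + wedge3 x x₃ y₃ := by
  have hcyc : ∀ x y z : V, wedge3 x y z = wedge3 y z x := fun x y z => by
    rw [wedge3_swap_left, wedge3_swap_right y x z, neg_neg]
  have key : ∀ x : V, ((pairSum x₁ y₁ x₂ y₂ x₃ y₃ : ⋀[ℂ]^2 V) : ExteriorAlgebra ℂ V) *
      ExteriorAlgebra.ι ℂ x =
      ((wedge3 x x₁ y₁ + wedge3 x x₂ y₂ + wedge3 x x₃ y₃ : ⋀[ℂ]^3 V) : ExteriorAlgebra ℂ V) := by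
    intro x
    rw [hcyc x x₁, hcyc x x₂, hcyc x x₃]
    simp [pairSum, coe_wedge3, ExteriorAlgebra.ιMulti_apply, add_mul]
  rw [wedgeSubspace, Submodule.mem_comap, Submodule.mem_span_singleton_mul]
  constructor
  · rintro ⟨m, hm, h⟩
    have hm' : m ∈ LinearMap.range (ExteriorAlgebra.ι ℂ : V →ₗ[ℂ] ExteriorAlgebra ℂ V) := by
      simpa using hm
    obtain ⟨x, rfl⟩ := hm'
    exact ⟨x, Subtype.ext (h.symm.trans (key x))⟩
  · rintro ⟨x, rfl⟩
    refine ⟨ExteriorAlgebra.ι ℂ x, ?_, key x⟩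
    simp

end TwoForms

section Structure

variable {V : Type*} [AddCommGroup V] [Module ℂ V]

variable {B : Basis (Fin 6) ℂ V} {Z : Submodule ℂ (⋀[ℂ]^3 V)}

theorem isSymplectic_pairSum (B : Basis (Fin 6) ℂ V) {y : V} (hy : B.repr y 5 ≠ 0) :
    IsSymplectic (pairSum (B 1) (B 2) (B 3) (B 4) (B 0) y) := by
  intro f hf
  simp only [dualForm_pairSum] at hf
  have h5 := hf (B.coord 5)
  have h0 := hf (B.coord 0)
  have h1 := hf (B.coord 1)
  have h2 := hf (B.coord 2)
  have h3 := hf (B.coord 3)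
  have h4 := hf (B.coord 4)
  simp at h5
  have f0 : f (B 0) = 0 := h5.resolve_right hy
  simp [f0] at h0 h1 h2 h3 h4
  have fy := h0
  rw [← B.sum_repr y, map_sum, Fin.sum_univ_six] at fy
  simp [f0, h1, h2, h3, h4, hy] at fy
  refine B.ext fun i => ?_
  fin_cases i
  · exact f0
  · exact h2
  · exact h1
  · exact h4
  · exact h3
  · exact fy

theorem leadingCoords_sigmaWedge (y x : V) :
    leadingCoords B (sigmaWedge B y x) =
      ![0, B.repr x 1, B.repr x 2, B.repr x 3, B.repr x 4, B.repr x 5] := by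
  ext i
  rw [sigmaWedge_apply]
  fin_cases i <;> simp [leadingCoords, coef_wedge3]

/-- If `y₅ = 0`, completing squares gives `ω + b₀ ∧ y = (b₁ + y₂ b₀) ∧ (b₂ - y₁ b₀) + (b₃ + y₄ b₀) ∧
(b₄ - y₃ b₀)`, so its wedge with `b₁ + y₂ b₀` is a nonzero decomposable form in `Z`. -/
theorem repr_ne_zero_of_sigmaWedge_mem (hGr : ∀ x y z, wedge3 x y z ∈ Z → wedge3 x y z = 0)
    {y : V} (hy : ∀ x, sigmaWedge B y x ∈ Z) : B.repr y 5 ≠ 0 := by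
  intro h5
  have key : sigmaWedge B y (B 1 + B.repr y 2 • B 0) =
      wedge3 (B 1 + B.repr y 2 • B 0) (B 3 + B.repr y 4 • B 0) (B 4 - B.repr y 3 • B 0) := by
    rw [sigmaWedge_apply]
    apply ext_coef_six B <;> rw [map_add, map_add] <;> simp [coef_wedge3, h5]
  have h := hy (B 1 + B.repr y 2 • B 0)
  rw [key] at h
  have h' := congrArg (coef B 1 3 4) (hGr _ _ _ h)
  simp [coef_wedge3] at h'

theorem exists_eq_wedgeSubspace [FiniteDimensional ℂ V] (hdim : finrank ℂ Z = 6)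
    (hGr : ∀ x y z, wedge3 x y z ∈ Z → wedge3 x y z = 0)
    (hz : wedge3 (B 0) (B 1) (B 2) + wedge3 (B 0) (B 3) (B 4) ∈ Z)
    (hC : ∀ u ∈ Z, coef B 1 3 5 u = 0 ∧ coef B 1 4 5 u = 0 ∧ coef B 2 3 5 u = 0 ∧
      coef B 2 4 5 u = 0 ∧ coef B 1 2 5 u = coef B 3 4 5 u)
    (hP : ∀ u ∈ Z, ∀ u' ∈ Z, mixedCoef B 1 3 5 u u' = 0 ∧ mixedCoef B 1 4 5 u u' = 0 ∧
      mixedCoef B 2 3 5 u u' = 0 ∧ mixedCoef B 2 4 5 u u' = 0 ∧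
      mixedCoef B 1 2 5 u u' = mixedCoef B 3 4 5 u u')
    (h₀ : ∃ u₀ ∈ Z, coef B 1 2 5 u₀ ≠ 0) :
    ∃ σ : ⋀[ℂ]^2 V, IsSymplectic σ ∧ Z = wedgeSubspace 3 σ := by
  obtain ⟨u₀, hu₀, h₀⟩ := h₀
  have hker : ∀ u ∈ Z, leadingCoords B u = 0 →
      ∃ r : ℂ, u = r • (wedge3 (B 0) (B 1) (B 2) + wedge3 (B 0) (B 3) (B 4)) :=
    fun u hu h => exists_eq_smul_of_leadingCoords_eq_zero hGr hz hC hP hu₀ h₀ hu h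
  have hsurj : ∀ t : Fin 6 → ℂ, t 0 = 0 → ∃ u ∈ Z, leadingCoords B u = t := by
    intro t ht
    -- Coordinate 0 of `leadingCoords` is identically zero; dropping it leaves a map to `ℂ⁵` whose
    -- kernel on the 6-dimensional `Z` is at most a line.
    obtain ⟨u, hu, h⟩ := exists_mem_apply_eq_of_ker_le_span Z
      (LinearMap.funLeft ℂ ℂ Fin.succ ∘ₗ leadingCoords B : ⋀[ℂ]^3 V →ₗ[ℂ] (Fin 5 → ℂ))
      (wedge3 (B 0) (B 1) (B 2) + wedge3 (B 0) (B 3) (B 4))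
      (fun u hu h => hker u hu (by
        ext i
        refine Fin.cases rfl (fun j => ?_) i
        exact congrFun h j)) (by rw [hdim, finrank_fin_fun]) (t ∘ Fin.succ)
    refine ⟨u, hu, ?_⟩
    ext i
    refine Fin.cases ht.symm (fun j => ?_) i
    exact congrFun h j
  obtain ⟨y, hy⟩ := exists_sigmaWedge_mem hz hC hP hsurj
  refine ⟨_, isSymplectic_pairSum B (repr_ne_zero_of_sigmaWedge_mem hGr hy), ?_⟩
  ext t
  rw [mem_wedgeSubspace_pairSum]
  constructor
  · intro ht
    -- Elements of `Z` with equal leading coordinates differ by a multiple of `b₀ ∧ ω`, which is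
    -- itself `sigmaWedge B y (B 0)`.
    obtain ⟨r, hr⟩ := hker (t - sigmaWedge B y (B.equivFun.symm (leadingCoords B t)))
      (Z.sub_mem ht (hy _)) (by
        rw [map_sub, leadingCoords_sigmaWedge, sub_eq_zero]
        simp only [repr_equivFun_symm]
        ext i
        fin_cases i <;> rfl)
    have h0 : sigmaWedge B y (B 0) =
        wedge3 (B 0) (B 1) (B 2) + wedge3 (B 0) (B 3) (B 4) := by
      rw [sigmaWedge_apply, wedge3_self_left, add_zero]
    refine ⟨r • B 0 + B.equivFun.symm (leadingCoords B t), ?_⟩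
    rw [← sigmaWedge_apply, map_add, map_smul, h0, ← hr, sub_add_cancel]
  · rintro ⟨x, rfl⟩
    exact hy x

end Structure

/-! ### Relative position of two 3-spaces. -/

section Configuration

variable {V : Type*} [AddCommGroup V] [Module ℂ V]

theorem linearIndependent_vec3_iff {x y z : V} : LinearIndependent ℂ ![x, y, z] ↔
    ∀ r s t : ℂ, r • x + s • y + t • z = 0 → r = 0 ∧ s = 0 ∧ t = 0 := by
  rw [Fintype.linearIndependent_iff]
  constructor
  · intro h r s t h0
    have h' := h ![r, s, t] (by simpa [Fin.sum_univ_three] using h0)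
    exact ⟨h' 0, h' 1, h' 2⟩
  · intro h g hg
    obtain ⟨h0, h1, h2⟩ := h (g 0) (g 1) (g 2) (by simpa [Fin.sum_univ_three] using hg)
    intro i
    fin_cases i <;> assumption

/-- A nonzero vector of a 3-space can be split off from its Plücker vector. -/
theorem exists_wedge3_eq_of_mem_span {x y z v : V} (hv : v ∈ Submodule.span ℂ {x, y, z})
    (hv0 : v ≠ 0) : ∃ a ∈ Submodule.span ℂ {x, y, z}, ∃ b ∈ Submodule.span ℂ {x, y, z},
      wedge3 v a b = wedge3 x y z := by
  have hx : x ∈ Submodule.span ℂ {x, y, z} := Submodule.subset_span (by simp)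
  have hy : y ∈ Submodule.span ℂ {x, y, z} := Submodule.subset_span (by simp)
  have hz : z ∈ Submodule.span ℂ {x, y, z} := Submodule.subset_span (by simp)
  obtain ⟨r, s, t, rfl⟩ := Submodule.mem_span_triple.1 hv
  by_cases hr : r = 0
  · by_cases hs : s = 0
    · have ht : t ≠ 0 := by
        rintro rfl
        simp [hr, hs] at hv0
      refine ⟨t⁻¹ • x, Submodule.smul_mem _ _ hx, y, hy, ?_⟩
      simp only [hr, hs, zero_smul, zero_add, map_smul, LinearMap.smul_apply, smul_smul]
      rw [inv_mul_cancel₀ ht, one_smul, wedge3_swap_left, wedge3_swap_right x z y, neg_neg]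
    · refine ⟨s⁻¹ • z, Submodule.smul_mem _ _ hz, x, hx, ?_⟩
      simp only [hr, zero_smul, zero_add, map_add, LinearMap.add_apply, map_smul,
        LinearMap.smul_apply, smul_smul, wedge3_self_left, smul_zero, add_zero]
      rw [inv_mul_cancel₀ hs, one_smul, wedge3_swap_right, wedge3_swap_left y x z, neg_neg]
  · refine ⟨r⁻¹ • y, Submodule.smul_mem _ _ hy, z, hz, ?_⟩
    simp only [map_add, LinearMap.add_apply, map_smul,
      LinearMap.smul_apply, smul_smul, wedge3_self_left, wedge3_self_outer, smul_zero, add_zero]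
    rw [inv_mul_cancel₀ hr, one_smul]

theorem range_vec3 {α : Type*} (a b c : α) : Set.range ![a, b, c] = {a, b, c} := by
  ext w
  simp [eq_comm]
  tauto

theorem span_triple_eq_of_mem {x y z v a b : V}
    (hv : v ∈ Submodule.span ℂ {x, y, z}) (ha : a ∈ Submodule.span ℂ {x, y, z})
    (hb : b ∈ Submodule.span ℂ {x, y, z}) (h : wedge3 v a b ≠ 0) :
    Submodule.span ℂ {v, a, b} = Submodule.span ℂ {x, y, z} := by
  have hle : Submodule.span ℂ {v, a, b} ≤ Submodule.span ℂ {x, y, z} := by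
    rw [Submodule.span_le]
    rintro w (rfl | rfl | rfl) <;> assumption
  have h1 := finrank_span_eq_card (linearIndependent_of_wedge3_ne_zero h)
  have h2 : finrank ℂ (Submodule.span ℂ {x, y, z}) ≤ 3 := by
    have h3 := finrank_range_le_card (R := ℂ) ![x, y, z]
    rwa [Set.finrank, range_vec3] at h3
  rw [range_vec3] at h1
  have : FiniteDimensional ℂ (Submodule.span ℂ {x, y, z}) :=
    FiniteDimensional.span_of_finite ℂ (Set.toFinite _)
  exact Submodule.eq_of_le_of_finrank_le hle (h2.trans h1.ge)

theorem exists_wedge3_eq_of_mem_span_pair {x y z v u : V}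
    (hv : v ∈ Submodule.span ℂ {x, y, z}) (hu : u ∈ Submodule.span ℂ {x, y, z}) (hv0 : v ≠ 0)
    (huv : u ∉ Submodule.span ℂ {v}) (hp : wedge3 x y z ≠ 0) :
    ∃ a ∈ Submodule.span ℂ {x, y, z}, wedge3 v u a = wedge3 x y z := by
  obtain ⟨a, ha, b, hb, h⟩ := exists_wedge3_eq_of_mem_span hv hv0
  have heq := span_triple_eq_of_mem hv ha hb (h ▸ hp)
  rw [← heq] at hu
  obtain ⟨r, s, t, rfl⟩ := Submodule.mem_span_triple.1 hu
  by_cases hs : s = 0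
  · have ht : t ≠ 0 := by
      rintro rfl
      exact huv (Submodule.mem_span_singleton.2 ⟨r, by simp [hs]⟩)
    refine ⟨-(t⁻¹ • a), Submodule.neg_mem _ (Submodule.smul_mem _ _ ha), ?_⟩
    rw [← h]
    simp only [hs, zero_smul, add_zero, map_add, LinearMap.add_apply, map_smul, map_neg,
      LinearMap.smul_apply, smul_smul, wedge3_self_left, smul_zero, zero_add]
    rw [inv_mul_cancel₀ ht, one_smul, wedge3_swap_right v a b]
  · refine ⟨s⁻¹ • b, Submodule.smul_mem _ _ hb, ?_⟩
    rw [← h]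
    simp only [map_add, LinearMap.add_apply, map_smul,
      LinearMap.smul_apply, smul_smul, wedge3_self_left, wedge3_self_right, smul_zero, zero_add,
      add_zero]
    rw [inv_mul_cancel₀ hs, one_smul]

theorem wedge3_ne_zero_of_not_mem_span {v u w : V} (hv0 : v ≠ 0)
    (huv : u ∉ Submodule.span ℂ {v}) (hw : w ∉ Submodule.span ℂ {v, u}) : wedge3 v u w ≠ 0 := by
  refine ιMulti_ne_zero (linearIndependent_vec3_iff.2 fun r s t h => ?_)
  have ht : t = 0 := by
    by_contra ht
    refine hw (Submodule.mem_span_pair.2 ⟨-(t⁻¹ * r), -(t⁻¹ * s), ?_⟩)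
    have h' := congrArg (t⁻¹ • ·) h
    simp only [smul_add, smul_smul, inv_mul_cancel₀ ht, one_smul, smul_zero] at h'
    rw [neg_smul, neg_smul, ← neg_add]
    exact (eq_neg_of_add_eq_zero_right h').symm
  subst ht
  rw [zero_smul, add_zero] at h
  have hs : s = 0 := by
    by_contra hs
    refine huv (Submodule.mem_span_singleton.2 ⟨-(s⁻¹ * r), ?_⟩)
    have h' := congrArg (s⁻¹ • ·) h
    simp only [smul_add, smul_smul, inv_mul_cancel₀ hs, one_smul, smul_zero] at h'
    rw [neg_smul]
    exact (eq_neg_of_add_eq_zero_right h').symm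
  subst hs
  rw [zero_smul, add_zero] at h
  exact ⟨(smul_eq_zero.1 h).resolve_right hv0, rfl, rfl⟩

/-- Two distinct 3-spaces meeting in a plane span a line contained in the Grassmannian. -/
theorem exists_wedge3_eq_add {x y z x' y' z' v u : V} (hp : wedge3 x y z ≠ 0)
    (hp' : wedge3 x' y' z' ≠ 0)
    (hne : Submodule.span ℂ {x, y, z} ≠ Submodule.span ℂ {x', y', z'})
    (hv : v ∈ Submodule.span ℂ {x, y, z}) (hv' : v ∈ Submodule.span ℂ {x', y', z'})
    (hu : u ∈ Submodule.span ℂ {x, y, z}) (hu' : u ∈ Submodule.span ℂ {x', y', z'})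
    (hv0 : v ≠ 0) (huv : u ∉ Submodule.span ℂ {v}) :
    ∃ w, wedge3 v u w = wedge3 x y z + wedge3 x' y' z' ∧ wedge3 v u w ≠ 0 := by
  obtain ⟨a, ha, h⟩ := exists_wedge3_eq_of_mem_span_pair hv hu hv0 huv hp
  obtain ⟨a', ha', h'⟩ := exists_wedge3_eq_of_mem_span_pair hv' hu' hv0 huv hp'
  refine ⟨a + a', by rw [map_add, h, h'], fun h0 => hne ?_⟩
  have hmem : a + a' ∈ Submodule.span ℂ {v, u} := by
    by_contra hw
    exact wedge3_ne_zero_of_not_mem_span hv0 huv hw h0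
  have hle : Submodule.span ℂ {v, u} ≤ Submodule.span ℂ {x, y, z} := by
    rw [Submodule.span_le]
    rintro w (rfl | rfl) <;> assumption
  have ha'' : a' ∈ Submodule.span ℂ {x, y, z} := by
    simpa using Submodule.sub_mem _ (hle hmem) ha
  rw [← span_triple_eq_of_mem hv hu ha'' (h' ▸ hp'),
    ← span_triple_eq_of_mem hv' hu' ha' (h' ▸ hp')]

theorem linearIndependent_of_span_inf_eq_bot {x y z x' y' z' : V} (hp : wedge3 x y z ≠ 0)
    (hp' : wedge3 x' y' z' ≠ 0)
    (h : ∀ w, w ∈ Submodule.span ℂ {x, y, z} → w ∈ Submodule.span ℂ {x', y', z'} → w = 0) :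
    LinearIndependent ℂ ![x, y, z, x', y', z'] := by
  have hl := linearIndependent_vec3_iff.1 (linearIndependent_of_wedge3_ne_zero hp)
  have hl' := linearIndependent_vec3_iff.1 (linearIndependent_of_wedge3_ne_zero hp')
  rw [Fintype.linearIndependent_iff]
  intro g hg
  simp [Fin.sum_univ_six] at hg
  have h0 := h (g 0 • x + g 1 • y + g 2 • z) (Submodule.mem_span_triple.2 ⟨_, _, _, rfl⟩)
    (Submodule.mem_span_triple.2 ⟨-g 3, -g 4, -g 5, by
      rw [← sub_eq_zero, ← neg_eq_zero, ← hg]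
      module⟩)
  rw [h0, zero_add] at hg
  obtain ⟨h1, h2, h3⟩ := hl _ _ _ h0
  obtain ⟨h4, h5, h6⟩ := hl' _ _ _ hg
  intro i
  fin_cases i <;> assumption

theorem linearIndependent_of_span_inf_le {v a b c d e : V} (hp : wedge3 v a b ≠ 0)
    (hp' : wedge3 v c d ≠ 0)
    (h : ∀ w, w ∈ Submodule.span ℂ {v, a, b} → w ∈ Submodule.span ℂ {v, c, d} →
      w ∈ Submodule.span ℂ {v}) (he : e ∉ Submodule.span ℂ (Set.range ![v, a, b, c, d])) :
    LinearIndependent ℂ ![v, a, b, c, d, e] := by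
  have hl := linearIndependent_vec3_iff.1 (linearIndependent_of_wedge3_ne_zero hp)
  have hl' := linearIndependent_vec3_iff.1 (linearIndependent_of_wedge3_ne_zero hp')
  rw [Fintype.linearIndependent_iff]
  intro g hg
  simp [Fin.sum_univ_six] at hg
  have g5 : g 5 = 0 := by
    by_contra h5
    apply he
    have hmem : g 5 • e ∈ Submodule.span ℂ (Set.range ![v, a, b, c, d]) := by
      rw [Submodule.mem_span_range_iff_exists_fun]
      refine ⟨![-g 0, -g 1, -g 2, -g 3, -g 4], ?_⟩
      simp [Fin.sum_univ_five]
      rw [← sub_eq_zero, ← neg_eq_zero, ← hg]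
      module
    exact (Submodule.smul_mem_iff _ h5).1 hmem
  rw [g5, zero_smul, add_zero] at hg
  obtain ⟨r, hr⟩ := Submodule.mem_span_singleton.1
    (h (g 0 • v + g 1 • a + g 2 • b) (Submodule.mem_span_triple.2 ⟨_, _, _, rfl⟩)
      (Submodule.mem_span_triple.2 ⟨0, -g 3, -g 4, by
        rw [← sub_eq_zero, ← neg_eq_zero, ← hg]
        module⟩))
  obtain ⟨-, g1, g2⟩ := hl (g 0 - r) (g 1) (g 2) (by
    rw [sub_smul, hr]
    module)
  rw [g1, g2, zero_smul, zero_smul, add_zero, add_zero] at hg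
  obtain ⟨g0, g3, g4⟩ := hl' _ _ _ hg
  intro i
  fin_cases i <;> assumption

end Configuration

/-! ### From a freely moving sum `p + p' ∈ Z` to a symplectic form. -/

section Structure

variable {V : Type*} [AddCommGroup V] [Module ℂ V]
  {𝔇 : Type*} [AddCommGroup 𝔇] [Module ℂ 𝔇] {Z : Submodule ℂ (⋀[ℂ]^3 V)}

theorem exists_basis_six (hV : finrank ℂ V = 6) {v : Fin 6 → V} (hv : LinearIndependent ℂ v) :
    ∃ B : Basis (Fin 6) ℂ V, ∀ i, B i = v i :=
  ⟨basisOfLinearIndependentOfCardEqFinrank hv (by simp [hV]), fun i => by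
    rw [coe_basisOfLinearIndependentOfCardEqFinrank]⟩

variable [FiniteDimensional ℂ V]

theorem LeibnizAction.exists_eq_wedgeSubspace_of_basis (A : LeibnizAction 𝔇 Z)
    (hdim : finrank ℂ Z = 6) (hZ : IsDisjointFromGr Z) (B : Basis (Fin 6) ℂ V)
    (hz : wedge3 (B 0) (B 1) (B 2) + wedge3 (B 0) (B 3) (B 4) ∈ Z)
    (hgen : ∀ g : V →ₗ[ℂ] V, ∃ D, A.onForms D (wedge3 (B 0) (B 1) (B 2)) =
      derivForm g (wedge3 (B 0) (B 1) (B 2))) :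
    ∃ σ : ⋀[ℂ]^2 V, IsSymplectic σ ∧ Z = wedgeSubspace 3 σ := by
  have hsurj : ∀ u ∈ Z, ∃ D,
      A.onForms D (wedge3 (B 0) (B 1) (B 2) + wedge3 (B 0) (B 3) (B 4)) = u :=
    fun u hu => A.exists_derivative_eq hdim B hz hgen hu
  refine exists_eq_wedgeSubspace hdim (fun x y z => eq_zero_of_wedge3_mem hZ) hz
    (fun u hu => A.coef_eq_zero B hsurj hu)
    (fun u hu u' hu' => A.mixedCoef_eq_zero B hz hsurj hu hu') ?_
  -- Moving `b₀` towards `b₅` produces the term `b₅ ∧ b₁ ∧ b₂`; the derivative of `b₀ ∧ b₃ ∧ b₄` has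
  -- no such component, whatever `D` does there.
  obtain ⟨D, hD⟩ := hgen (B.constr ℂ ![B 5, 0, 0, 0, 0, 0])
  refine ⟨_, A.map_mem D _ hz, ?_⟩
  rw [A.onForms_add, hD, A.leibniz, derivForm_wedge3]
  simp [coef_wedge3]

/-- If `p + p' ∈ Z` for two distinct points of the Grassmannian, where `p` moves freely, then `Z`
is the space of multiples of a symplectic form. -/
theorem LeibnizAction.exists_eq_wedgeSubspace (A : LeibnizAction 𝔇 Z) (hV : finrank ℂ V = 6)
    (hdim : finrank ℂ Z = 6) (hZ : IsDisjointFromGr Z) {x y z x' y' z' : V}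
    (hp : wedge3 x y z ≠ 0) (hp' : wedge3 x' y' z' ≠ 0)
    (hne : Submodule.span ℂ {x, y, z} ≠ Submodule.span ℂ {x', y', z'})
    (hz : wedge3 x y z + wedge3 x' y' z' ∈ Z)
    (hgen : ∀ g : V →ₗ[ℂ] V, ∃ D, A.onForms D (wedge3 x y z) = derivForm g (wedge3 x y z)) :
    ∃ σ : ⋀[ℂ]^2 V, IsSymplectic σ ∧ Z = wedgeSubspace 3 σ := by
  by_cases h0 : ∀ w, w ∈ Submodule.span ℂ {x, y, z} → w ∈ Submodule.span ℂ {x', y', z'} → w = 0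
  · obtain ⟨B, hB⟩ := exists_basis_six hV (linearIndependent_of_span_inf_eq_bot hp hp' h0)
    exact (A.false_of_disjoint hdim B (by simpa [hB] using hz) (by simpa [hB] using hgen)).elim
  · push Not at h0
    obtain ⟨v, hv, hv', hv0⟩ := h0
    have h1 : ∀ w, w ∈ Submodule.span ℂ {x, y, z} → w ∈ Submodule.span ℂ {x', y', z'} →
        w ∈ Submodule.span ℂ {v} := by
      intro u hu hu'
      by_contra huv
      obtain ⟨w, hw, hw0⟩ := exists_wedge3_eq_add hp hp' hne hv hv' hu hu' hv0 huv
      exact hw0 (eq_zero_of_wedge3_mem hZ (hw ▸ hz))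
    obtain ⟨a, ha, b, hb, h⟩ := exists_wedge3_eq_of_mem_span hv hv0
    obtain ⟨c, hc, d, hd, h'⟩ := exists_wedge3_eq_of_mem_span hv' hv0
    rw [← span_triple_eq_of_mem hv ha hb (h ▸ hp), ← span_triple_eq_of_mem hv' hc hd (h' ▸ hp')]
      at h1
    rw [← h] at hp hz hgen
    rw [← h'] at hp' hz
    obtain ⟨e, he⟩ : ∃ e, e ∉ Submodule.span ℂ (Set.range ![v, a, b, c, d]) := by
      by_contra! hcon
      have htop := (Submodule.eq_top_iff').2 hcon
      have hle := finrank_range_le_card (R := ℂ) ![v, a, b, c, d]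
      rw [Set.finrank, htop, finrank_top, hV] at hle
      simp at hle
    obtain ⟨B, hB⟩ := exists_basis_six hV (linearIndependent_of_span_inf_le hp hp' h1 he)
    exact A.exists_eq_wedgeSubspace_of_basis hdim hZ B (by simpa [hB] using hz)
      (by simpa [hB] using hgen)

end Structure

/-! ### Generic fibers and the case `d > 1`. -/

section Fibers

variable {V : Type*} [AddCommGroup V] [Module ℂ V] [FiniteDimensional ℂ V]
  {Z : Submodule ℂ (⋀[ℂ]^3 V)}

/-- The fiber through the span of a generic triple of vectors has `d` elements. -/
theorem HasDegree.exists_poly {n : ℕ} (b : Basis (Fin n) ℂ V) (hn : 3 ≤ n)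
    {hZ : IsDisjointFromGr Z} {d : ℕ} (hd : HasDegree (grProjection Z hZ) d) :
    ∃ G : MvPolynomial (Fin 3 × Fin n) ℂ, G ≠ 0 ∧ ∀ e : Fin 3 → V,
      MvPolynomial.eval (fun q : Fin 3 × Fin n => b.repr (e q.1) q.2) G ≠ 0 →
      ∃ he : LinearIndependent ℂ e, (grProjection Z hZ ⁻¹'
        {grProjection Z hZ (Gr.ofLinearIndependent e he)}).encard = d := by
  obtain ⟨U, hU, hcl, hfib⟩ := hd
  have hl : LinearIndependent ℂ (b ∘ Fin.castLE hn) :=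
    b.linearIndependent.comp _ (Fin.castLE_injective hn)
  -- Density is needed only for nonemptiness: a polynomial that is nonzero at one triple already
  -- describes a generic condition.
  obtain ⟨_, hyU, Λ, rfl⟩ : (U ∩ Set.range (grProjection Z hZ)).Nonempty := by
    rw [Set.nonempty_iff_ne_empty]
    intro hempty
    rw [hempty] at hcl
    have := hcl ⟨Gr.ofLinearIndependent _ hl, rfl⟩
    rw [@closure_empty _ (zariskiTopology _)] at this
    exact this
  obtain ⟨e₀, he₀, rfl⟩ := Gr.exists_basis Λ
  obtain ⟨G, hG₀, hG⟩ := exists_poly_of_isOpen b hZ hU e₀ he₀ hyU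
  -- The extra factor `triplePoly b φ` forces `e` to be linearly independent.
  obtain ⟨φ, hφ⟩ : ∃ φ : Dual ℂ (⋀[ℂ]^3 V), φ (exteriorPower.ιMulti ℂ 3 e₀) ≠ 0 := by
    by_contra! hcon
    exact ιMulti_ne_zero he₀ ((Module.forall_dual_apply_eq_zero_iff ℂ _).1 hcon)
  refine ⟨G * triplePoly b φ, fun h0 => ?_, fun e he => ?_⟩
  · have h := congrArg (MvPolynomial.eval (fun q : Fin 3 × Fin n => b.repr (e₀ q.1) q.2)) h0
    rw [map_mul, eval_triplePoly, map_zero] at h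
    exact (mul_ne_zero hG₀ hφ) h
  · rw [map_mul, eval_triplePoly] at he
    have hl : LinearIndependent ℂ e := by
      by_contra hl
      apply right_ne_zero_of_mul he
      rw [(exteriorPower.ιMulti ℂ 3).map_linearDependent e hl, map_zero]
    exact ⟨hl, hfib _ ⟨hG e hl (left_ne_zero_of_mul he), _, rfl⟩⟩

theorem HasDegree.exists_eq_wedgeSubspace (hV : finrank ℂ V = 6) (hdim : finrank ℂ Z = 6)
    {hZ : IsDisjointFromGr Z} {d : ℕ} (hd : HasDegree (grProjection Z hZ) d) (h1 : 1 < d) :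
    ∃ σ : ⋀[ℂ]^2 V, IsSymplectic σ ∧ Z = wedgeSubspace 3 σ := by
  let b := finBasisOfFinrankEq ℂ V hV
  obtain ⟨G, hG, hfib⟩ := hd.exists_poly b (by norm_num)
  obtain ⟨ι, _, B, hB⟩ := exists_adapted_basis Z
  obtain ⟨k, a, hS, ha, hder⟩ := exists_generic_point
    (Set.range fun q : Fin 6 × Fin 6 × Fin 6 × ι =>
      B.repr (wedge3 (b q.1) (b q.2.1) (b q.2.2.1)) q.2.2.2) (Set.countable_range _) G hG
  let A := LeibnizAction.ofBasis b B (fun i j l m => hS ⟨(i, j, l, m), rfl⟩) Z hB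
  let e : Fin 3 → V := fun i => b.equivFun.symm fun j => a (i, j)
  have hrepr : ∀ i j, b.repr (e i) j = a (i, j) := fun i j => repr_equivFun_symm _ _ _
  obtain ⟨he, hcard⟩ := hfib e (by simpa only [hrepr] using ha)
  obtain ⟨Λ, hΛ, hne⟩ : ∃ Λ, grProjection Z hZ Λ =
      grProjection Z hZ (Gr.ofLinearIndependent e he) ∧ Λ ≠ Gr.ofLinearIndependent e he := by
    have h1' : 1 < (grProjection Z hZ ⁻¹'
        {grProjection Z hZ (Gr.ofLinearIndependent e he)}).encard := by
      rw [hcard]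
      exact_mod_cast h1
    obtain ⟨Λ, hΛ, hne⟩ := (Set.one_lt_encard_iff_nontrivial.1 h1').exists_ne
      (Gr.ofLinearIndependent e he)
    exact ⟨Λ, hΛ, hne⟩
  obtain ⟨f, hf, rfl⟩ := Gr.exists_basis Λ
  obtain ⟨c, hc⟩ := (grProjection_eq_iff hZ he hf).1 hΛ.symm
  have hp := ιMulti_ne_zero he
  have hq := ιMulti_ne_zero hf
  rw [ιMulti_eq_wedge3] at hp hq
  rw [ιMulti_eq_wedge3, ιMulti_eq_wedge3] at hc
  have hc0 : c ≠ 0 := by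
    rintro rfl
    rw [zero_smul, sub_zero] at hc
    exact hp (eq_zero_of_wedge3_mem hZ hc)
  -- Absorbing `-c` into the first vector turns `p - c q ∈ Z` into a sum of two decomposables.
  have hq' : wedge3 (-c • f 0) (f 1) (f 2) = -(c • wedge3 (f 0) (f 1) (f 2)) := by
    rw [map_smul, LinearMap.smul_apply, LinearMap.smul_apply, neg_smul]
  have hq0 : wedge3 (-c • f 0) (f 1) (f 2) ≠ 0 := by
    rw [hq']
    exact neg_ne_zero.2 (smul_ne_zero hc0 hq)
  have hspan : ∀ w : Fin 3 → V, Submodule.span ℂ {w 0, w 1, w 2} =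
      Submodule.span ℂ (Set.range w) := fun w => by
    rw [← range_vec3]
    congr 2
    ext i
    fin_cases i <;> rfl
  refine A.exists_eq_wedgeSubspace hV hdim hZ hp hq0 (fun h => hne ?_) ?_ fun g => ?_
  · rw [span_triple_eq_of_mem (x := f 0) (y := f 1) (z := f 2)
      (Submodule.smul_mem _ _ (Submodule.subset_span (by simp)))
      (Submodule.subset_span (by simp)) (Submodule.subset_span (by simp)) hq0,
      hspan, hspan] at h
    exact Subtype.ext h.symm
  · rw [hq', ← sub_eq_add_neg]
    exact hc
  -- The coordinates of `e` are generic, so some `D` sends every `e i` to `g (e i)`.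
  · obtain ⟨D, hD⟩ := hder fun q => b.repr (g (e q.1)) q.2
    refine ⟨D, ?_⟩
    have hV' : ∀ i, A.onV D (e i) = g (e i) := fun i => by
      change coordDeriv b D (e i) = _
      apply b.ext_elem
      intro j
      rw [repr_coordDeriv, hrepr, hD]
    rw [A.leibniz, derivForm_wedge3, hV', hV', hV']

end Fibers

/-! ### Symplectic bases adapted to a non-isotropic 3-space. -/

section SymplecticBasis

variable {V : Type*} [AddCommGroup V] [Module ℂ V] {ω : V →ₗ[ℂ] V →ₗ[ℂ] ℂ}

/-- The component of `x` orthogonal to a hyperbolic plane. -/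
theorem exists_orthogonal_to_pair (hω : ω.IsAlt) {p q : V} (h : ω p q = 1) (x : V) :
    ∃ r s : ℂ, ω (x + r • p + s • q) p = 0 ∧ ω (x + r • p + s • q) q = 0 := by
  have h' : ω q p = -1 := by rw [← hω.neg, h]
  refine ⟨-ω x q, ω x p, ?_, ?_⟩ <;> simp [h, h', hω.self_eq_zero]

/-- The expansion of a vector in a symplectic basis. -/
theorem eq_sum_of_symplecticBasis (hV : finrank ℂ V = 6) {v : Fin 6 → V}
    (h : ∀ i j, ω (v i) (v j) = !![0, 1, 0, 0, 0, 0; -1, 0, 0, 0, 0, 0; 0, 0, 0, 1, 0, 0;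
      0, 0, -1, 0, 0, 0; 0, 0, 0, 0, 0, 1; 0, 0, 0, 0, -1, 0] i j) (x : V) :
    x = (ω x (v 1) • v 0 - ω x (v 0) • v 1) + (ω x (v 3) • v 2 - ω x (v 2) • v 3) +
      (ω x (v 5) • v 4 - ω x (v 4) • v 5) := by
  have hl : LinearIndependent ℂ v := by
    rw [Fintype.linearIndependent_iff]
    intro g hg
    have key : ∀ j, ω (∑ i, g i • v i) (v j) = 0 := fun j => by rw [hg]; simp
    have h0 := key 0
    have h1 := key 1
    have h2 := key 2
    have h3 := key 3
    have h4 := key 4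
    have h5 := key 5
    simp [Fin.sum_univ_six, h] at h0 h1 h2 h3 h4 h5
    intro i
    fin_cases i <;> assumption
  obtain ⟨B, hB⟩ := exists_basis_six hV hl
  have key : (LinearMap.id : V →ₗ[ℂ] V) =
      ((ω.flip (v 1)).smulRight (v 0) - (ω.flip (v 0)).smulRight (v 1)) +
      ((ω.flip (v 3)).smulRight (v 2) - (ω.flip (v 2)).smulRight (v 3)) +
      ((ω.flip (v 5)).smulRight (v 4) - (ω.flip (v 4)).smulRight (v 5)) := by
    refine B.ext fun i => ?_
    rw [hB]
    fin_cases i <;> simp [h]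
  exact LinearMap.congr_fun key x

/-- Symplectic Gram–Schmidt started on the hyperbolic plane of `e 0, e 1`. The vector `v 4` is the
part of `e 2` orthogonal to that plane, so it spans the radical of `ω` on the 3-space. -/
theorem exists_symplecticBasis (hV : finrank ℂ V = 6) (hω : ω.IsAlt)
    (hnd : ∀ x, x ≠ 0 → ∃ y, ω x y ≠ 0) {e : Fin 3 → V} (he : LinearIndependent ℂ e)
    (h01 : ω (e 0) (e 1) ≠ 0) :
    ∃ v : Fin 6 → V, (∀ i j, ω (v i) (v j) = !![0, 1, 0, 0, 0, 0; -1, 0, 0, 0, 0, 0;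
      0, 0, 0, 1, 0, 0; 0, 0, -1, 0, 0, 0; 0, 0, 0, 0, 0, 1; 0, 0, 0, 0, -1, 0] i j) ∧
      v 0 = e 0 ∧ e 1 = ω (e 0) (e 1) • v 1 ∧ ∃ r s : ℂ, e 2 = v 4 + r • v 0 + s • v 1 := by
  have : FiniteDimensional ℂ V := FiniteDimensional.of_finrank_pos (by omega)
  have hone : ∀ x, x ≠ 0 → ∃ y, ω x y = 1 := fun x hx => by
    obtain ⟨y, hy⟩ := hnd x hx
    exact ⟨(ω x y)⁻¹ • y, by rw [map_smul, smul_eq_mul, inv_mul_cancel₀ hy]⟩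
  set a := e 0 with ha
  set b := (ω (e 0) (e 1))⁻¹ • e 1 with hb
  have hab : ω a b = 1 := by rw [hb, map_smul, smul_eq_mul, inv_mul_cancel₀ h01]
  have he1 : e 1 = ω (e 0) (e 1) • b := by rw [hb, smul_smul, mul_inv_cancel₀ h01, one_smul]
  obtain ⟨r, s, hva, hvb⟩ := exists_orthogonal_to_pair hω hab (e 2)
  set v := e 2 + r • a + s • b with hv
  have hv0 : v ≠ 0 := by
    intro h0
    have h := Fintype.linearIndependent_iff.1 he ![r, s * (ω (e 0) (e 1))⁻¹, 1] (by
      rw [Fin.sum_univ_three, ← h0, hv, hb, ha]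
      simp
      module) 2
    simp at h
  obtain ⟨w', hw'⟩ := hone v hv0
  obtain ⟨r', s', hwa, hwb⟩ := exists_orthogonal_to_pair hω hab w'
  set w := w' + r' • a + s' • b with hw
  have hvw : ω v w = 1 := by simp [hw, hw', hva, hvb]
  -- Four linear conditions on a 6-dimensional space leave a nonzero vector orthogonal to both
  -- planes found so far.
  obtain ⟨c, hc, hc0⟩ := (Submodule.ne_bot_iff _).1 (LinearMap.ker_ne_bot_of_finrank_lt
    (f := (LinearMap.pi ![ω a, ω b, ω v, ω w] : V →ₗ[ℂ] Fin 4 → ℂ)) (by simp [hV]))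
  rw [LinearMap.mem_ker] at hc
  have hca : ω a c = 0 := congrFun hc 0
  have hcb : ω b c = 0 := congrFun hc 1
  have hcv : ω v c = 0 := congrFun hc 2
  have hcw : ω w c = 0 := congrFun hc 3
  have hac : ω c a = 0 := by rw [← hω.neg, hca, neg_zero]
  have hbc : ω c b = 0 := by rw [← hω.neg, hcb, neg_zero]
  have hvc : ω c v = 0 := by rw [← hω.neg, hcv, neg_zero]
  have hwc : ω c w = 0 := by rw [← hω.neg, hcw, neg_zero]
  have hav : ω a v = 0 := by rw [← hω.neg, hva, neg_zero]
  have hbv : ω b v = 0 := by rw [← hω.neg, hvb, neg_zero]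
  have haw : ω a w = 0 := by rw [← hω.neg, hwa, neg_zero]
  have hbw : ω b w = 0 := by rw [← hω.neg, hwb, neg_zero]
  have hba : ω b a = -1 := by rw [← hω.neg, hab]
  have hwv : ω w v = -1 := by rw [← hω.neg, hvw]
  obtain ⟨d'', hd''⟩ := hone c hc0
  obtain ⟨r₁, s₁, hda', hdb'⟩ := exists_orthogonal_to_pair hω hab d''
  set d' := d'' + r₁ • a + s₁ • b with hd'
  obtain ⟨r₂, s₂, hdv, hdw⟩ := exists_orthogonal_to_pair hω hvw d'
  set d := d' + r₂ • v + s₂ • w with hd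
  have hcd : ω c d = 1 := by simp [hd, hd', hd'', hac, hbc, hvc, hwc]
  have hda : ω d a = 0 := by simp [hd, hda', hva, hwa]
  have hdb : ω d b = 0 := by simp [hd, hdb', hvb, hwb]
  have had : ω a d = 0 := by rw [← hω.neg, hda, neg_zero]
  have hbd : ω b d = 0 := by rw [← hω.neg, hdb, neg_zero]
  have hvd : ω v d = 0 := by rw [← hω.neg, hdv, neg_zero]
  have hwd : ω w d = 0 := by rw [← hω.neg, hdw, neg_zero]
  have hdc : ω d c = -1 := by rw [← hω.neg, hcd]
  refine ⟨![a, b, c, d, v, w], fun i j => ?_, rfl, he1, -r, -s, ?_⟩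
  · clear_value a b v w d d'
    fin_cases i <;> fin_cases j <;> simp only [Fin.zero_eta, Fin.mk_one,
      Fin.reduceFinMk, Matrix.cons_val, Matrix.of_apply, Matrix.cons_val_zero, Matrix.cons_val_one,
      hω.self_eq_zero, hab, hba, hcd, hdc, hvw, hwv, hca, hcb, hcv,
      hcw, hac, hbc, hvc, hwc, hva, hvb, hav, hbv, hwa, hwb, haw, hbw, hda, hdb, hdv, hdw, had,
      hbd, hvd, hwd]
  · change e 2 = v + -r • a + -s • b
    rw [hv]
    module

end SymplecticBasis

/-! ### 2-forms as alternating forms on the dual, and their inverses. -/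

section TwoFormDuality

variable {V : Type*} [AddCommGroup V] [Module ℂ V]

theorem eq_of_dualForm_eq {ι : Type*} [LinearOrder ι] (b : Basis ι ℂ V) {σ τ : ⋀[ℂ]^2 V}
    (h : ∀ f g, dualForm σ f g = dualForm τ f g) : σ = τ := by
  apply (b.exteriorPower 2).repr.injective
  ext u
  rw [exteriorPower.basis_repr_apply, exteriorPower.basis_repr_apply]
  have hc : exteriorPower.ιMultiDual ℂ 2 b u = exteriorPower.pairingDual ℂ V 2
      (exteriorPower.ιMulti ℂ 2 ![b.coord (Set.powersetCard.ofFinEmbEquiv.symm u 0),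
        b.coord (Set.powersetCard.ofFinEmbEquiv.symm u 1)]) := by
    rw [exteriorPower.ιMultiDual, exteriorPower.ιMulti_family]
    congr 2
  rw [hc]
  exact h _ _

theorem dualForm_self (σ : ⋀[ℂ]^2 V) (f : Dual ℂ V) : dualForm σ f f = 0 := by
  rw [dualForm, (exteriorPower.ιMulti ℂ 2).map_eq_zero_of_eq ![f, f] (i := 0) (j := 1) rfl
    (by decide), map_zero, LinearMap.zero_apply]

theorem dualForm_add_left (σ : ⋀[ℂ]^2 V) (f f' g : Dual ℂ V) :
    dualForm σ (f + f') g = dualForm σ f g + dualForm σ f' g := by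
  have h := (exteriorPower.ιMulti ℂ 2).map_vecCons_add ![g] f f'
  rw [dualForm, h, map_add]
  rfl

theorem dualForm_smul_left (σ : ⋀[ℂ]^2 V) (c : ℂ) (f g : Dual ℂ V) :
    dualForm σ (c • f) g = c * dualForm σ f g := by
  have h := (exteriorPower.ιMulti ℂ 2).map_vecCons_smul ![g] c f
  rw [dualForm, h, map_smul]
  rfl

theorem dualForm_swap (σ : ⋀[ℂ]^2 V) (f g : Dual ℂ V) : dualForm σ f g = -dualForm σ g f := by
  have h := (exteriorPower.ιMulti ℂ 2).map_swap ![g, f] (i := 0) (j := 1) (by decide)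
  have h' : (![g, f] ∘ Equiv.swap (0 : Fin 2) 1 : Fin 2 → Dual ℂ V) = ![f, g] := by
    ext i : 1
    fin_cases i <;> rfl
  rw [h'] at h
  rw [dualForm, h, map_neg]
  rfl

/-- The bilinear form of a 2-form, as a linear map to the dual. -/
noncomputable def dualFormLinear (σ : ⋀[ℂ]^2 V) : Dual ℂ V →ₗ[ℂ] Dual ℂ (Dual ℂ V) :=
  LinearMap.mk₂ ℂ (dualForm σ) (dualForm_add_left σ) (dualForm_smul_left σ)
    (fun f g g' => by
      rw [dualForm_swap, dualForm_add_left, dualForm_swap σ f g, dualForm_swap σ f g', neg_add])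
    (fun c f g => by
      rw [dualForm_swap, dualForm_smul_left, dualForm_swap σ f g, smul_eq_mul, mul_neg])

theorem exists_poly_eq_bilin {n : ℕ} (b : Basis (Fin n) ℂ V) (ω : V →ₗ[ℂ] V →ₗ[ℂ] ℂ) :
    ∃ P : MvPolynomial (Fin 3 × Fin n) ℂ, ∀ e : Fin 3 → V,
      MvPolynomial.eval (fun q : Fin 3 × Fin n => b.repr (e q.1) q.2) P = ω (e 0) (e 1) := by
  refine ⟨∑ i, ∑ j, MvPolynomial.X (0, i) * MvPolynomial.X (1, j) *
    MvPolynomial.C (ω (b i) (b j)), fun e => ?_⟩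
  conv_rhs => rw [← b.sum_repr (e 0), ← b.sum_repr (e 1)]
  simp only [map_sum, map_mul, MvPolynomial.eval_X, MvPolynomial.eval_C, LinearMap.sum_apply,
    map_smul, LinearMap.smul_apply, smul_eq_mul, Finset.mul_sum]
  rw [Finset.sum_comm]
  exact Finset.sum_congr rfl fun i _ => Finset.sum_congr rfl fun j _ => by ring

variable [FiniteDimensional ℂ V]

/-- The symplectic form on `V` which is inverse to a symplectic form on the dual. -/
theorem IsSymplectic.exists_inverse {σ : ⋀[ℂ]^2 V} (hσ : IsSymplectic σ) :
    ∃ ω : V →ₗ[ℂ] V →ₗ[ℂ] ℂ, ω.IsAlt ∧ (∀ x, x ≠ 0 → ∃ y, ω x y ≠ 0) ∧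
      ∀ f : Dual ℂ V, ∃ x, (∀ y, ω x y = -f y) ∧ ∀ g, dualForm σ f g = g x := by
  let S₀ : Dual ℂ V →ₗ[ℂ] V := (evalEquiv ℂ V).symm.toLinearMap ∘ₗ dualFormLinear σ
  have hS₀ : ∀ f g, g (S₀ f) = dualForm σ f g := fun f g => by
    change g ((evalEquiv ℂ V).symm (dualFormLinear σ f)) = _
    rw [apply_evalEquiv_symm_apply]
    rfl
  have hinj : Function.Injective S₀ := by
    rw [← LinearMap.ker_eq_bot, LinearMap.ker_eq_bot']
    intro f hf
    exact hσ f fun g => by rw [← hS₀, hf, map_zero]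
  let S : Dual ℂ V ≃ₗ[ℂ] V := S₀.linearEquivOfInjective hinj Subspace.dual_finrank_eq
  have hS : ∀ f g, g (S f) = dualForm σ f g := hS₀
  -- With this sign, `σ = v₀ ∧ v₁ + ⋯` corresponds to `ω(v₀, v₁) = 1`.
  refine ⟨-S.symm.toLinearMap, fun x => ?_, fun x hx => ?_,
    fun f => ⟨S f, fun y => ?_, fun g => ?_⟩⟩
  · obtain ⟨f, rfl⟩ := S.surjective x
    change -(S.symm (S f) (S f)) = 0
    rw [S.symm_apply_apply, hS, dualForm_self, neg_zero]
  · by_contra! hcon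
    apply hx
    apply S.symm.injective
    rw [map_zero]
    exact LinearMap.ext fun y => by simpa using hcon y
  · simp
  · exact (hS f g).symm

end TwoFormDuality

/-! ### Self-adjoint centers have degree greater than one. -/

section SelfAdjointFibers

variable {V : Type*} [AddCommGroup V] [Module ℂ V] [FiniteDimensional ℂ V]
  {Z : Submodule ℂ (⋀[ℂ]^3 V)}

/-- A 3-space which is not isotropic lies in a fiber with another point. -/
theorem exists_ne_grProjection_eq (hV : finrank ℂ V = 6) (hZ : IsDisjointFromGr Z)
    {σ : ⋀[ℂ]^2 V} (hσZ : wedgeSubspace 3 σ ≤ Z) {ω : V →ₗ[ℂ] V →ₗ[ℂ] ℂ} (hω : ω.IsAlt)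
    (hnd : ∀ x, x ≠ 0 → ∃ y, ω x y ≠ 0)
    (hinv : ∀ f : Dual ℂ V, ∃ x, (∀ y, ω x y = -f y) ∧ ∀ g, dualForm σ f g = g x)
    {e : Fin 3 → V} (he : LinearIndependent ℂ e) (h01 : ω (e 0) (e 1) ≠ 0) :
    ∃ Λ, Λ ≠ Gr.ofLinearIndependent e he ∧
      grProjection Z hZ Λ = grProjection Z hZ (Gr.ofLinearIndependent e he) := by
  obtain ⟨v, hv, h0, h1, r, s, h2⟩ := exists_symplecticBasis hV hω hnd he h01
  have hσ : σ = pairSum (v 0) (v 1) (v 2) (v 3) (v 4) (v 5) := by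
    refine eq_of_dualForm_eq (finBasisOfFinrankEq ℂ V hV) fun f g => ?_
    obtain ⟨x, hx, hfg⟩ := hinv f
    rw [hfg, dualForm_pairSum, eq_sum_of_symplecticBasis hV hv x]
    simp [hx]
    ring
  -- `v₄ ∧ σ` is a Plücker vector of the given 3-space plus a second decomposable form.
  have hmem : wedge3 (v 4) (v 0) (v 1) + wedge3 (v 4) (v 2) (v 3) ∈ Z := by
    apply hσZ
    rw [hσ, mem_wedgeSubspace_pairSum]
    exact ⟨v 4, by rw [wedge3_self_left, add_zero]⟩
  have hew : exteriorPower.ιMulti ℂ 3 e = ω (e 0) (e 1) • wedge3 (v 4) (v 0) (v 1) := by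
    rw [ιMulti_eq_wedge3, h2, ← h0]
    conv_lhs => rw [h1]
    simp only [map_add, map_smul, LinearMap.smul_apply, wedge3_self_right, wedge3_self_outer,
      smul_zero, add_zero]
    rw [wedge3_swap_left (v 4), wedge3_swap_right (v 0) (v 4), neg_neg, h0]
  have hl : LinearIndependent ℂ ![v 4, v 2, v 3] := by
    rw [linearIndependent_vec3_iff]
    intro r s t h
    have key : ∀ j, ω (r • v 4 + s • v 2 + t • v 3) (v j) = 0 := fun j => by rw [h]; simp
    have h2 := key 2
    have h3 := key 3
    have h5 := key 5
    simp [hv] at h2 h3 h5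
    exact ⟨h5, h3, h2⟩
  refine ⟨Gr.ofLinearIndependent _ hl, fun h => ?_, ?_⟩
  -- The functional `ω(v₃, ·)` vanishes on the given 3-space but not at `v₂`, so the two spaces
  -- differ.
  · have hle : Submodule.span ℂ (Set.range e) ≤ LinearMap.ker (ω (v 3)) := by
      rw [Submodule.span_le]
      rintro _ ⟨i, rfl⟩
      fin_cases i
      · simp [← h0, hv]
      · change ω (v 3) (e 1) = 0
        conv_lhs => rw [h1]
        simp [hv]
      · simp [h2, hv]
    have h' : Submodule.span ℂ (Set.range ![v 4, v 2, v 3]) = Submodule.span ℂ (Set.range e) :=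
      congrArg Subtype.val h
    have hmem' : v 2 ∈ LinearMap.ker (ω (v 3)) :=
      hle (h' ▸ Submodule.subset_span ⟨1, rfl⟩)
    simp [hv] at hmem'
  · symm
    rw [grProjection_eq_iff]
    refine ⟨-ω (e 0) (e 1), ?_⟩
    have hsum : ∀ (c : ℂ) (s t : ⋀[ℂ]^3 V), c • s - -c • t = c • (s + t) := fun c s t => by module
    rw [hew, ← wedge3_apply, hsum]
    exact Z.smul_mem _ hmem

theorem HasDegree.one_lt_of_isSelfAdjoint (hV : finrank ℂ V = 6)
    {hZ : IsDisjointFromGr Z} {d : ℕ} (hd : HasDegree (grProjection Z hZ) d)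
    (hsa : IsSelfAdjoint Z) : 1 < d := by
  obtain ⟨σ, hσ, hσZ⟩ := hsa
  obtain ⟨ω, hω, hnd, hinv⟩ := hσ.exists_inverse
  let b := finBasisOfFinrankEq ℂ V hV
  obtain ⟨G, hG, hfib⟩ := hd.exists_poly b (by norm_num)
  obtain ⟨y, hy⟩ := hnd (b 0) (b.ne_zero 0)
  obtain ⟨P, hP⟩ := exists_poly_eq_bilin b ω
  have hP0 : P ≠ 0 := fun h0 => by
    have h := hP ![b 0, y, 0]
    rw [h0, map_zero] at h
    exact hy h.symm
  obtain ⟨a, ha⟩ : ∃ a, MvPolynomial.eval a (G * P) ≠ 0 := by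
    by_contra! hcon
    exact mul_ne_zero hG hP0 (MvPolynomial.funext fun a => by rw [hcon, map_zero])
  obtain ⟨e, rfl⟩ : ∃ e : Fin 3 → V, a = fun q : Fin 3 × Fin 6 => b.repr (e q.1) q.2 :=
    ⟨fun i => b.equivFun.symm fun j => a (i, j), funext fun q =>
      (repr_equivFun_symm b (fun j => a (q.1, j)) q.2).symm⟩
  rw [map_mul, hP] at ha
  obtain ⟨he, hcard⟩ := hfib e (left_ne_zero_of_mul ha)
  obtain ⟨Λ, hne, hΛ⟩ := exists_ne_grProjection_eq hV hZ hσZ hω hnd hinv he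
    (right_ne_zero_of_mul ha)
  have h1 : 1 < (grProjection Z hZ ⁻¹'
      {grProjection Z hZ (Gr.ofLinearIndependent e he)}).encard := by
    rw [Set.one_lt_encard_iff]
    refine ⟨Λ, Gr.ofLinearIndependent e he, ?_, ?_, hne⟩
    · rw [Set.mem_preimage, Set.mem_singleton_iff, hΛ]
    · rw [Set.mem_preimage, Set.mem_singleton_iff]
  rw [hcard] at h1
  exact_mod_cast h1

end SelfAdjointFibers
end GrassmannProjection

theorem theorem3p12 {V : Type*} [AddCommGroup V] [Module ℂ V] [FiniteDimensional ℂ V]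
    (hV : Module.finrank ℂ V = 6)
    (Z : Submodule ℂ (⋀[ℂ]^3 V))
    (hdim : Module.finrank ℂ Z = 6)
    (hZ : GrassmannProjection.IsDisjointFromGr Z)
    (d : ℕ) (hd : GrassmannProjection.HasDegree (GrassmannProjection.grProjection Z hZ) d) :
    (1 < d ↔ GrassmannProjection.IsSelfAdjoint Z) ∧
    (1 < d → ∃ σ : ⋀[ℂ]^2 V, GrassmannProjection.IsSymplectic σ ∧
      Z = GrassmannProjection.wedgeSubspace 3 σ) := by
  refine ⟨⟨fun h => ?_, hd.one_lt_of_isSelfAdjoint hV⟩, hd.exists_eq_wedgeSubspace hV hdim⟩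
  obtain ⟨σ, hσ, h⟩ := hd.exists_eq_wedgeSubspace hV hdim h
  exact ⟨σ, hσ, h.ge⟩
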